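/- Let $M$ agents $i\in\mathcal I=\{1,\dots,M\}$ have decision variables $x_i\in\mathbb R^{m_i}$, let $m=\sum_i m_i$ and $\boldsymbol x=(x_1,\dots,x_M)\in\mathbb R^m$, and let $J_i:\mathbb R^m\to\mathbb R$ be the cost of agent $i$ and $\Omega_i\subset\mathbb R^{m_i}$ its action set; $\Omega=\Omega_1\times\dots\times\Omega_M$. Assume: 1. every $J_i$ is continuously differentiable on $\mathbb R^m$, and $J_i(\cdot,\boldsymbol x_{-i})$ is strictly convex for every $\boldsymbol x_{-i}$; 2. the pseudogradient $F(\boldsymbol x)=\operatorname{col}(\nabla_{x_i}J_i(x_i,\boldsymbol x_{-i}))_{i}$ is strongly monotone and Lipschitz: for some $\mu_f>0$ and $L$, $\langle \boldsymbol x-\boldsymbol y,F(\boldsymbol x)-F(\boldsymbol y)\rangle\ge\mu_f\|\boldsymbol x-\boldsymbol y\|^2$ and $\|F(\boldsymbol x)-F(\boldsymbol y)\|\le L\|\boldsymbol x-\boldsymbol y\|$ for all $\boldsymbol x,\boldsymbol y\in\mathbb R^m$; 3. every $\Omega_i$ is nonempty, convex, closed and bounded; 4. the frequencies $\omega_i^j>0$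 ($i\in\mathcal I$, $j\le m_i$) satisfy $\omega_i^j+\omega_u^v\notin 2\pi\mathbb Z$ for all pairs $(i,j),(u,v)$ (equal ones included) and $\omega_i^j-\omega_u^v\notin2\pi\mathbb Z$ for all $(i,j)\ne(u,v)$. Then the game has exactly one Nash equilibrium $\boldsymbol x^*$, i.e. one point $\boldsymbol x^*\in\Omega$ with $J_i(\boldsymbol x^*)\le J_i(v_i,\boldsymbol x^*_{-i})$ for all $i$ and $v_i\in\Omega_i$. Fix $\gamma>0$ and consider, for parameters $\alpha,\beta>0$ and amplitudes $a=(a_i^j)$, $a_i^j>0$, the algorithm $$\begin{aligned}\boldsymbol x^+&=(1-\alpha\beta)\boldsymbol x+\alpha\beta\,\mathrm{proj}_{\Omega}(\boldsymbol x-\gamma\boldsymbol\xi),\\ \boldsymbol\xi^+&=(1-\alpha)\boldsymbol\xi+2\alpha A^{-1}J(\boldsymbol x+A\mathbb D\boldsymbol\mu)\,\mathbb D\boldsymbol\mu,\\ \boldsymbol\mu^+&=\mathcal R\boldsymbol\mu,\end{aligned}$$ with state $z=(\boldsymbol x,\boldsymbol\xi,\boldsymbol\mu)\in\mathbb R^m\times\mathbb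 R^m\times\mathbb S^m$. Here $\mathbb S^m\subset\mathbb R^{2m}$ is the product of $m$ unit circles, $\mathcal R$ rotates the circle $(i,j)$ by the angle $\omega_i^j$, $\mathbb D\boldsymbol\mu\in\mathbb R^m$ collects the first coordinates of the $m$ circles, $A=\operatorname{diag}(a)$ and $J(\boldsymbol x)=\operatorname{Diag}(J_i(\boldsymbol x)I_{m_i})_i$. Let $C_F$ be the closed convex hull of $F(\Omega)$, $\mathcal A=\{\boldsymbol x^*\}\times C_F\times\mathbb S^m$, $\|z\|_{\mathcal A}$ the Euclidean distance from $z$ to $\mathcal A$, $\bar a=\max a_i^j$, and let a bound $\rho\ge1$ on the ratios $a_i^j/a_u^v$ of the amplitudes be fixed. Then $\mathcal A$ is semi-globally practically asymptotically stable (SGPAS) as $(\alpha,\bar a,\beta)\to0$: there is a function $\kappa$ of class $\mathcal{KL}$ such that for all $\Delta>\nu>0$ there is $\bar\beta>0$ such that for every $\beta\in(0,\bar\beta)$ there is $a^\circ>0$ such that for all amplitudes $a$ with ratios at most $\rho$ and $\bar a<a^\circ$ there is $\bar\alpha>0$ such that for every $\alpha\in(0,\bar\alpha)$ every trajectory with $\|z(0)\|_{\mathcal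 A}\le\Delta$ satisfies $$\|z(k)\|_{\mathcal A}\le\kappa(\|z(0)\|_{\mathcal A},\,\alpha\beta k)+\nu\qquad\text{for all }k\in\mathbb N.$$ -/

import Mathlib

open Filter Topology

/-- The space `ℝ^m`, `m = m_1 + … + m_M`, of collective vectors `x = col(x_1, …, x_M)`
with `x_i ∈ ℝ^{m_i}`, carrying the Euclidean norm. Here `d i` is the dimension `m_i`. -/
abbrev Profile {M : ℕ} (d : Fin M → ℕ) : Type :=
  PiLp 2 fun i : Fin M => EuclideanSpace ℝ (Fin (d i))

/-- The space `ℝ^{2m}` of oscillator states: a vector `(μ_{ij,0}, μ_{ij,1}) ∈ ℝ²` for every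
coordinate `j` of every agent `i`. -/
abbrev Oscillators {M : ℕ} (d : Fin M → ℕ) : Type :=
  PiLp 2 fun i : Fin M => PiLp 2 fun _ : Fin (d i) => EuclideanSpace ℝ (Fin 2)

/-- The state space `ℝ^m × ℝ^m × ℝ^{2m}` of triples `(x, ξ, μ)`, with the Euclidean norm. -/
abbrev State {M : ℕ} (d : Fin M → ℕ) : Type :=
  WithLp 2 (Profile d × WithLp 2 (Profile d × Oscillators d))

namespace State

variable {M : ℕ} {d : Fin M → ℕ}

/-- The triple `(x, ξ, μ)` as a state. -/
def mk (x ξ : Profile d) (μ : Oscillators d) : State d :=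
  WithLp.toLp 2 (x, WithLp.toLp 2 (ξ, μ))

/-- The decision variables of a state. -/
def x (z : State d) : Profile d := z.fst

/-- The filter states of a state. -/
def ξ (z : State d) : Profile d := z.snd.fst

/-- The oscillator states of a state. -/
def μ (z : State d) : Oscillators d := z.snd.snd

end State

section Game

variable {M : ℕ} {d : Fin M → ℕ}

/-- The profile `(v, x_{-i})`: agent `i` plays `v`, the others play as in `x`. -/
def deviate (x : Profile d) (i : Fin M) (v : EuclideanSpace ℝ (Fin (d i))) : Profile d :=
  WithLp.toLp 2 (Function.update (WithLp.ofLp x) i v)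

/-- The product `Ω_1 × … × Ω_M` of the action sets. -/
def actionSet (Ω : (i : Fin M) → Set (EuclideanSpace ℝ (Fin (d i)))) : Set (Profile d) :=
  {x | ∀ i, x i ∈ Ω i}

/-- `x` is a Nash equilibrium: every `x_i` minimizes `J_i(·, x_{-i})` over `Ω_i`. -/
def IsNash (J : Fin M → Profile d → ℝ)
    (Ω : (i : Fin M) → Set (EuclideanSpace ℝ (Fin (d i)))) (x : Profile d) : Prop :=
  x ∈ actionSet Ω ∧ ∀ i, ∀ v ∈ Ω i, J i x ≤ J i (deviate x i v)

/-- The pseudogradient `F(x) = col(∇_{x_i} J_i(x_i, x_{-i}))_i`. -/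
noncomputable def pseudogradient (J : Fin M → Profile d → ℝ) (x : Profile d) : Profile d :=
  WithLp.toLp 2 fun i => gradient (fun v => J i (deviate x i v)) (x i)

/-- The set `C_F`, the closed convex hull of the image `F(Ω)`. -/
noncomputable def gradientHull (J : Fin M → Profile d → ℝ)
    (Ω : (i : Fin M) → Set (EuclideanSpace ℝ (Fin (d i)))) : Set (Profile d) :=
  closure (convexHull ℝ (pseudogradient J '' actionSet Ω))

/-- The product `𝕊^m` of `m` unit circles. -/
def torus (d : Fin M → ℕ) : Set (Oscillators d) :=
  {μ | ∀ i j, μ i j 0 ^ 2 + μ i j 1 ^ 2 = 1}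

/-- The Euclidean projection of `y` onto `C`: the point of `C` nearest to `y`
(it exists and is unique when `C` is nonempty, closed and convex). -/
noncomputable def euclideanProj (C : Set (Profile d)) (y : Profile d) : Profile d :=
  Classical.epsilon fun p => p ∈ C ∧ ∀ q ∈ C, ‖y - p‖ ≤ ‖y - q‖

/-- The vector `𝔻 μ`: the first component of every oscillator. -/
def dither (μ : Oscillators d) : Profile d :=
  WithLp.toLp 2 fun i => WithLp.toLp 2 fun j => μ i j 0

/-- The vector `A y` where `A = diag(a)`. -/
def scale (a : (i : Fin M) → Fin (d i) → ℝ) (y : Profile d) : Profile d :=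
  WithLp.toLp 2 fun i => WithLp.toLp 2 fun j => a i j * y i j

/-- The rotation `μ ↦ ℛ μ`: the oscillator `(i, j)` turns by the angle `ω i j`. -/
noncomputable def rotate (ω : (i : Fin M) → Fin (d i) → ℝ) (μ : Oscillators d) : Oscillators d :=
  WithLp.toLp 2 fun i => WithLp.toLp 2 fun j =>
    !₂[Real.cos (ω i j) * μ i j 0 - Real.sin (ω i j) * μ i j 1,
      Real.sin (ω i j) * μ i j 0 + Real.cos (ω i j) * μ i j 1]

/-- The zeroth-order estimate `2 A⁻¹ J(x + A 𝔻 μ) 𝔻 μ` of the pseudogradient: its entry `(i, j)`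
is `(2 / a_{ij}) J_i(x + A 𝔻 μ) (𝔻 μ)_{ij}`. -/
noncomputable def gradientEstimate (J : Fin M → Profile d → ℝ) (a : (i : Fin M) → Fin (d i) → ℝ)
    (x : Profile d) (μ : Oscillators d) : Profile d :=
  WithLp.toLp 2 fun i => WithLp.toLp 2 fun j =>
    2 / a i j * J i (x + scale a (dither μ)) * dither μ i j

/-- One step of the zeroth-order projected forward-backward algorithm. -/
noncomputable def algorithmStep (J : Fin M → Profile d → ℝ)
    (Ω : (i : Fin M) → Set (EuclideanSpace ℝ (Fin (d i))))
    (ω : (i : Fin M) → Fin (d i) → ℝ) (γ α : ℝ) (a : (i : Fin M) → Fin (d i) → ℝ) (β : ℝ)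
    (z : State d) : State d :=
  State.mk
    ((1 - α * β) • z.x + (α * β) • euclideanProj (actionSet Ω) (z.x - γ • z.ξ))
    ((1 - α) • z.ξ + α • gradientEstimate J a z.x z.μ)
    (rotate ω z.μ)

/-- The trajectories of the algorithm: `x` and `ξ` start anywhere in `ℝ^m`, `μ` starts in `𝕊^m`. -/
def trajectories (J : Fin M → Profile d → ℝ)
    (Ω : (i : Fin M) → Set (EuclideanSpace ℝ (Fin (d i))))
    (ω : (i : Fin M) → Fin (d i) → ℝ) (γ α : ℝ) (a : (i : Fin M) → Fin (d i) → ℝ) (β : ℝ) :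
    Set (ℕ → State d) :=
  {z | (z 0).μ ∈ torus d ∧ ∀ k, z (k + 1) = algorithmStep J Ω ω γ α a β (z k)}

/-- The set `{x*} × C_F × 𝕊^m`. -/
def targetSet (J : Fin M → Profile d → ℝ)
    (Ω : (i : Fin M) → Set (EuclideanSpace ℝ (Fin (d i)))) (xs : Profile d) : Set (State d) :=
  {z | z.x = xs ∧ z.ξ ∈ gradientHull J Ω ∧ z.μ ∈ torus d}

/-- The largest amplitude `ā = max a_{ij}`. -/
noncomputable def maxAmplitude (a : (i : Fin M) → Fin (d i) → ℝ) : ℝ :=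
  ⨆ p : (i : Fin M) × Fin (d i), a p.1 p.2

/-- The positive amplitude vectors whose entries differ at most by the factor `ρ`. -/
def amplitudes (d : Fin M → ℕ) (ρ : ℝ) : Set ((i : Fin M) → Fin (d i) → ℝ) :=
  {a | (∀ i j, 0 < a i j) ∧ ∀ i j u v, a i j ≤ ρ * a u v}

end Game

/-- Class `𝒦ℒ`: a continuous function `[0,∞) × [0,∞) → [0,∞)` that is zero at zero and strictly
increasing in the first argument, and non-increasing with limit zero in the second one. -/
structure IsClassKL (κ : ℝ → ℝ → ℝ) : Prop where
  continuousOn : ContinuousOn (Function.uncurry κ) (Set.Ici 0 ×ˢ Set.Ici 0)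
  nonneg : ∀ r s, 0 ≤ r → 0 ≤ s → 0 ≤ κ r s
  zero : ∀ s, 0 ≤ s → κ 0 s = 0
  strictMonoOn : ∀ s, 0 ≤ s → StrictMonoOn (fun r => κ r s) (Set.Ici 0)
  antitoneOn : ∀ r, 0 ≤ r → AntitoneOn (κ r) (Set.Ici 0)
  tendsto : ∀ r, 0 ≤ r → Tendsto (κ r) atTop (𝓝 0)

/-- Semi-global practical asymptotic stability of the set `𝒜` as `(α, ā, β) → 0` for a family of
discrete-time systems with trajectories `Sol α a β`. The parameters are tuned one after the other:
first `β`, then `a ∈ P` through its size `ā = size a`, then `α`.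

The bound is uniform in the parameters; the time `k` enters it as the slow time `αβk`, because the
state of a system with step size `αβ` moves by `O(αβ)` in one step. -/
def IsSGPAS {Z Θ : Type*} [PseudoMetricSpace Z] (Sol : ℝ → Θ → ℝ → Set (ℕ → Z)) (P : Set Θ)
    (size : Θ → ℝ) (𝒜 : Set Z) : Prop :=
  ∃ κ : ℝ → ℝ → ℝ, IsClassKL κ ∧ ∀ Δ ν : ℝ, 0 < ν → ν < Δ →
    ∃ βmax > 0, ∀ β, 0 < β → β < βmax →
    ∃ amax > 0, ∀ a ∈ P, size a < amax →
    ∃ αmax > 0, ∀ α, 0 < α → α < αmax →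
      ∀ z ∈ Sol α a β, Metric.infDist (z 0) 𝒜 ≤ Δ →
        ∀ k : ℕ, Metric.infDist (z k) 𝒜 ≤ κ (Metric.infDist (z 0) 𝒜) (α * β * k) + ν

/-! By convexity the Nash equilibria are exactly the solutions of the variational inequality of the
pseudogradient F over Ω. A projected fixed-point iteration with a suitable step produces a solution,
and strong monotonicity makes it unique.

Stability rests on three ingredients. First, since γ is arbitrary, the forward-backward map x ↦
proj(x - γF(x)) need not be a contraction. However, short relaxed steps towards it decrease a
Lyapunov function: the regularized gap max over y ∈ C of γ⟨F(x), x - y⟩ - ‖x - y‖²/2, plus a penalty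
on infeasibility, because trajectories may start outside Ω (`gap_step`, `gapLyapunov_step`). It
controls ‖x - x*‖² through the natural residual.

Second, averaging (`exists_corrector`). Expanding the costs to first order, the estimate is F(x)
plus non-resonant oscillations plus a small Taylor error. Summation by parts turns the oscillations
into P(k+1) - P(k) plus a small remainder. P is of order 1/a but does not depend on α, so αP is
small once a is fixed. The corrected state χ = ξ - αP then obeys a low-pass filter driven by F(x),
with a perturbation of size αβ per step.

Third, time-scale separation (`exists_norm_sub_sq_bound`). The tracking error W = ‖χ - F(x)‖
contracts at rate α, while x moves only by O(αβ). A combination V + O(β)·W of gap and tracking error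
therefore contracts at the slow rate αβ up to O(β), and the initial tracking error costs only O(β).
Finally, the infeasibility of x decays like (1 - αβ)^k, so F(x) approaches C_F at that rate and the
filter follows (`exists_hull_near`). -/

/-! ### Metric projections, the forward-backward residual and descent of the gap function. -/

section MetricProjection

variable {E : Type*} [NormedAddCommGroup E] [InnerProductSpace ℝ E]

/-- `π` is the metric projection onto the convex set `C`, by its variational characterization. -/
def IsMetricProjection (C : Set E) (π : E → E) : Prop :=
  ∀ y, π y ∈ C ∧ ∀ q ∈ C, inner ℝ (y - π y) (q - π y) ≤ 0

namespace IsMetricProjection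

variable {C : Set E} {π : E → E}

theorem norm_sub_le (hπ : IsMetricProjection C π) (y : E) {q : E} (hq : q ∈ C) :
    ‖y - π y‖ ≤ ‖y - q‖ := by
  have h1 := (hπ y).2 q hq
  have h2 : ‖y - q‖ ^ 2 = ‖y - π y‖ ^ 2 - 2 * inner ℝ (y - π y) (q - π y) + ‖q - π y‖ ^ 2 := by
    rw [← norm_sub_sq_real]; congr 2; abel
  exact le_of_sq_le_sq (by nlinarith [sq_nonneg ‖q - π y‖]) (norm_nonneg _)

theorem norm_map_sub_le (hπ : IsMetricProjection C π) (y z : E) :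
    ‖π y - π z‖ ≤ ‖y - z‖ := by
  have h1 := (hπ y).2 _ (hπ z).1
  have h2 := (hπ z).2 _ (hπ y).1
  have h3 : inner ℝ (y - z) (π y - π z) - ‖π y - π z‖ ^ 2
      = -(inner ℝ (y - π y) (π z - π y) + inner ℝ (z - π z) (π y - π z)) := by
    rw [← real_inner_self_eq_norm_sq]
    simp only [inner_sub_left, inner_sub_right]
    rw [real_inner_comm (π y) (π z)]
    ring
  have h4 := real_inner_le_norm (y - z) (π y - π z)
  by_contra! h
  have : 0 < ‖π y - π z‖ := (norm_nonneg _).trans_lt h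
  nlinarith

end IsMetricProjection

/-- The data of a strongly monotone, Lipschitz variational inequality over a set `C` with metric
projection `π`, together with a step size `γ`. -/
structure IsStrongVI (F : E → E) (C : Set E) (π : E → E) (m L γ : ℝ) : Prop where
  m_pos : 0 < m
  L_nonneg : 0 ≤ L
  γ_pos : 0 < γ
  mono : ∀ x y, m * ‖x - y‖ ^ 2 ≤ inner ℝ (x - y) (F x - F y)
  lip : ∀ x y, ‖F x - F y‖ ≤ L * ‖x - y‖
  proj : IsMetricProjection C π

/-- The residual `π (x - γ F x) - x` of the forward-backward operator. -/
def fbResidual (F : E → E) (π : E → E) (γ : ℝ) (x : E) : E := π (x - γ • F x) - x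

/-- The slack of the variational inequality that characterizes the forward-backward point. -/
def fbSlack (F : E → E) (π : E → E) (γ : ℝ) (x : E) : ℝ :=
  -inner ℝ (γ • F x + fbResidual F π γ x) (fbResidual F π γ x)

/-- Regularized gap function plus a penalty on the distance to the feasible set. -/
noncomputable def gapLyapunov (F : E → E) (π : E → E) (γ K₁ K₂ : ℝ) (x : E) : ℝ :=
  fbSlack F π γ x + ‖fbResidual F π γ x‖ ^ 2 / 2 + K₁ * ‖x - π x‖ + K₂ * ‖x - π x‖ ^ 2

namespace IsStrongVI

variable {F : E → E} {C : Set E} {π : E → E} {m L γ : ℝ}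

theorem norm_fb_sub_le (h : IsStrongVI F C π m L γ) (x y : E) :
    ‖π (x - γ • F x) - π (y - γ • F y)‖ ≤ (1 + γ * L) * ‖x - y‖ := by
  refine (h.proj.norm_map_sub_le _ _).trans ?_
  have : x - γ • F x - (y - γ • F y) = (x - y) - γ • (F x - F y) := by rw [smul_sub]; abel
  rw [this]
  refine (_root_.norm_sub_le _ _).trans ?_
  rw [norm_smul, Real.norm_of_nonneg h.γ_pos.le]
  nlinarith [h.lip x y, h.γ_pos]

theorem fb_eq_of_vi (h : IsStrongVI F C π m L γ) {xs : E} (hxs : xs ∈ C)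
    (hvi : ∀ y ∈ C, 0 ≤ inner ℝ (F xs) (y - xs)) : π (xs - γ • F xs) = xs := by
  have h1 := (h.proj (xs - γ • F xs)).2 xs hxs
  have h2 := hvi _ (h.proj (xs - γ • F xs)).1
  set p := π (xs - γ • F xs)
  have h3 : inner ℝ (xs - γ • F xs - p) (xs - p) = ‖xs - p‖ ^ 2 + γ * inner ℝ (F xs) (p - xs) := by
    rw [← real_inner_self_eq_norm_sq]
    simp only [inner_sub_left, inner_sub_right, inner_smul_left, RCLike.conj_to_real]
    ring
  have h4 := mul_nonneg h.γ_pos.le h2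
  have h5 : ‖xs - p‖ = 0 := by
    have : ‖xs - p‖ ^ 2 ≤ 0 := by linarith
    exact pow_eq_zero_iff two_ne_zero |>.1 (le_antisymm this (sq_nonneg _))
  exact (sub_eq_zero.1 (norm_eq_zero.1 h5)).symm

/-- The residual measures the distance to the solution: testing the projection inequality at the
solution, and the variational inequality at the forward-backward point, leaves only terms linear in
the residual against the strong monotonicity term. -/
theorem error_bound (h : IsStrongVI F C π m L γ) {xs : E} (hxs : xs ∈ C)
    (hvi : ∀ y ∈ C, 0 ≤ inner ℝ (F xs) (y - xs)) (x : E) :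
    γ * m * ‖x - xs‖ ≤ (1 + γ * L) * ‖fbResidual F π γ x‖ := by
  have h1 := (h.proj (x - γ • F x)).2 xs hxs
  have h2 := mul_nonneg h.γ_pos.le (hvi _ (h.proj (x - γ • F x)).1)
  have hp : π (x - γ • F x) = x + fbResidual F π γ x := by simp [fbResidual]
  rw [hp] at h1 h2
  set q := fbResidual F π γ x
  -- On the right, the first inner product is nonpositive by the projection inequality and the
  -- second enters with a minus sign and is nonnegative, so only the two terms to be bounded by
  -- Cauchy–Schwarz survive.
  have h3 : γ * inner ℝ (x - xs) (F x - F xs) + ‖q‖ ^ 2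
      = inner ℝ (x - γ • F x - (x + q)) (xs - (x + q)) - γ * inner ℝ (F xs) (x + q - xs)
        - inner ℝ (x - xs) q - γ * inner ℝ (F x - F xs) q := by
    rw [← real_inner_self_eq_norm_sq]
    simp only [inner_sub_left, inner_sub_right, inner_add_left, inner_add_right, inner_smul_left,
      RCLike.conj_to_real]
    simp only [real_inner_comm x (F x), real_inner_comm xs (F x), real_inner_comm x (F xs),
      real_inner_comm xs (F xs), real_inner_comm x q, real_inner_comm xs q,
      real_inner_comm q (F x), real_inner_comm q (F xs)]
    ring
  have h4 := h.mono x xs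
  have h5 := neg_le_of_abs_le (abs_real_inner_le_norm (x - xs) q)
  have h6 := neg_le_of_abs_le (abs_real_inner_le_norm (F x - F xs) q)
  have h7 := h.lip x xs
  have h8 : ‖F x - F xs‖ * ‖q‖ ≤ L * ‖x - xs‖ * ‖q‖ :=
    mul_le_mul_of_nonneg_right h7 (norm_nonneg _)
  have h9 : γ * m * ‖x - xs‖ * ‖x - xs‖ ≤ (1 + γ * L) * ‖q‖ * ‖x - xs‖ := by
    nlinarith [h.γ_pos, mul_le_mul_of_nonneg_left h4 h.γ_pos.le,
      mul_le_mul_of_nonneg_left (h6.trans' (neg_le_neg h8)) h.γ_pos.le, sq_nonneg ‖q‖]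
  rcases (norm_nonneg (x - xs)).eq_or_lt with h0 | h0
  · rw [← h0, mul_zero]
    have := h.γ_pos; have := h.L_nonneg; positivity
  · exact le_of_mul_le_mul_right h9 h0

/-- The forward-backward point maximizes the regularized gap. -/
theorem gap_le (h : IsStrongVI F C π m L γ) (x : E) {y : E} (hy : y ∈ C) :
    γ * inner ℝ (F x) (x - y) - ‖x - y‖ ^ 2 / 2 ≤
      fbSlack F π γ x + ‖fbResidual F π γ x‖ ^ 2 / 2 := by
  have h1 := h.proj.norm_sub_le (x - γ • F x) hy
  have hp : π (x - γ • F x) = x + fbResidual F π γ x := by simp [fbResidual]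
  rw [hp] at h1
  unfold fbSlack
  set q := fbResidual F π γ x
  have h2 : ‖x - γ • F x - (x + q)‖ ^ 2 ≤ ‖x - γ • F x - y‖ ^ 2 := by gcongr
  have e1 : x - γ • F x - (x + q) = -(γ • F x + q) := by abel
  have e2 : x - γ • F x - y = (x - y) - γ • F x := by abel
  rw [e1, e2, norm_neg, norm_add_sq_real, norm_sub_sq_real, inner_smul_left, inner_smul_right,
    real_inner_comm (F x) (x - y), RCLike.conj_to_real] at h2
  rw [inner_add_left, real_inner_self_eq_norm_sq, inner_smul_left, RCLike.conj_to_real]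
  linarith

/-- An envelope argument that never differentiates F: the forward-backward point of the new iterate
is a competitor in the maximization defining the old gap. The increment of F contributes the
decrease γm‖q‖² by strong monotonicity, and the motion along the residual q contributes the slack.
-/
theorem gap_step (h : IsStrongVI F C π m L γ) {x d : E} {t N : ℝ} (ht : 0 < t)
    (hd : ‖d‖ ≤ N) (hq : ‖fbResidual F π γ x‖ ≤ N)
    (hF : ‖γ • F x + fbResidual F π γ x‖ ≤ N) :
    fbSlack F π γ (x + t • d) + ‖fbResidual F π γ (x + t • d)‖ ^ 2 / 2 ≤
      fbSlack F π γ x + ‖fbResidual F π γ x‖ ^ 2 / 2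
        - t * (fbSlack F π γ x + γ * m * ‖fbResidual F π γ x‖ ^ 2)
        + t * (γ * L * N * (1 + (2 + γ * L) * N) + N + (1 + γ * L) * N ^ 2 + 2 * γ * m * N)
          * (‖d - fbResidual F π γ x‖ + t) := by
  have hγ := h.γ_pos
  have hL := h.L_nonneg
  have hm := h.m_pos
  have hN : 0 ≤ N := (norm_nonneg _).trans hd
  have h1 := h.gap_le x (h.proj (x + t • d - γ • F (x + t • d))).1
  have hw := h.norm_fb_sub_le x (x + t • d)
  have hp : π (x - γ • F x) = x + fbResidual F π γ x := by simp [fbResidual]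
  have hy : ∀ z, fbResidual F π γ z = π (z - γ • F z) - z := fun z => rfl
  have hlip := h.lip (x + t • d) x
  have hmono := h.mono (x + t • d) x
  unfold fbSlack at h1 ⊢
  rw [hp] at hw
  rw [hy (x + t • d)]
  set y := π (x + t • d - γ • F (x + t • d))
  set q := fbResidual F π γ x
  -- Three increments: w is minus the motion of the forward-backward point, e the deviation of the
  -- direction from the residual, G the change of F.
  obtain ⟨w, rfl'⟩ : ∃ w, y = x + q - w := ⟨x + q - y, by abel⟩
  obtain ⟨e, rfl⟩ : ∃ e, d = q + e := ⟨d - q, by abel⟩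
  obtain ⟨G, hG⟩ : ∃ G, F (x + t • (q + e)) = F x + G := ⟨F (x + t • (q + e)) - F x, by abel⟩
  rw [rfl', hG]
  rw [rfl'] at h1 hw
  rw [hG] at hlip hmono
  have e1 : x + q - (x + q - w) = w := by abel
  have e2 : x - (x + t • (q + e)) = -(t • (q + e)) := by abel
  have e3 : x + t • (q + e) - x = t • (q + e) := by abel
  have e4 : x + q - w - (x + t • (q + e)) = q - w - t • (q + e) := by abel
  have e5 : x - (x + q - w) = w - q := by abel
  have e6 : F x + G - F x = G := by abel
  have e7 : q + e - q = e := by abel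
  rw [e1, e2, norm_neg, norm_smul, Real.norm_of_nonneg ht.le] at hw
  rw [e3, e6, norm_smul, Real.norm_of_nonneg ht.le] at hlip
  rw [e3, e6, norm_smul, Real.norm_of_nonneg ht.le, inner_smul_left, RCLike.conj_to_real] at hmono
  rw [e5] at h1
  rw [e4, e7]
  -- The first two terms are the old gap objective at the new forward-backward point, which `h1`
  -- bounds; the bracket holds the decrease and the errors.
  have key : -inner ℝ (γ • (F x + G) + (q - w - t • (q + e))) (q - w - t • (q + e))
        + ‖q - w - t • (q + e)‖ ^ 2 / 2
      = γ * inner ℝ (F x) (w - q) - ‖w - q‖ ^ 2 / 2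
        + (γ * inner ℝ G (t • (q + e) + w + e) - γ * inner ℝ (q + e) G
          + t * inner ℝ (γ • F x + q) q + t * inner ℝ (γ • F x + q) e
          - t * inner ℝ (q + e) w - t ^ 2 * ‖q + e‖ ^ 2 / 2) := by
    simp only [← real_inner_self_eq_norm_sq, inner_sub_left, inner_sub_right, inner_add_left,
      inner_add_right, inner_smul_left, inner_smul_right, RCLike.conj_to_real]
    simp only [real_inner_comm q w, real_inner_comm q e, real_inner_comm q G, real_inner_comm e G,
      real_inner_comm e w]
    ring
  rw [key]
  have b1 : inner ℝ G (t • (q + e) + w + e) ≤ L * (t * N) * (t * N + (1 + γ * L) * (t * N) + ‖e‖) := by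
    refine (real_inner_le_norm _ _).trans ?_
    have hn : ‖t • (q + e) + w + e‖ ≤ t * N + (1 + γ * L) * (t * N) + ‖e‖ := by
      refine (norm_add₃_le).trans ?_
      rw [norm_smul, Real.norm_of_nonneg ht.le]
      have : (1 + γ * L) * (t * ‖q + e‖) ≤ (1 + γ * L) * (t * N) := by gcongr
      have : t * ‖q + e‖ ≤ t * N := by gcongr
      linarith
    have : ‖G‖ ≤ L * (t * N) := hlip.trans (by gcongr)
    gcongr
  have b2 : m * t * ‖q + e‖ ^ 2 ≤ inner ℝ (q + e) G := by
    refine le_of_mul_le_mul_left ?_ ht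
    calc t * (m * t * ‖q + e‖ ^ 2) = m * (t * ‖q + e‖) ^ 2 := by ring
      _ ≤ _ := hmono
  have b3 : inner ℝ (γ • F x + q) e ≤ N * ‖e‖ :=
    (real_inner_le_norm _ _).trans (by gcongr)
  have b4 : -inner ℝ (q + e) w ≤ N * ((1 + γ * L) * (t * N)) := by
    have h1 := neg_le_of_abs_le (abs_real_inner_le_norm (q + e) w)
    have h2 : ‖q + e‖ * ‖w‖ ≤ N * ((1 + γ * L) * (t * N)) := by
      have : ‖w‖ ≤ (1 + γ * L) * (t * N) := hw.trans (by gcongr)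
      gcongr
    linarith
  have b5 : ‖q‖ ^ 2 - 2 * N * ‖e‖ ≤ ‖q + e‖ ^ 2 := by
    rw [norm_add_sq_real]
    have := neg_le_of_abs_le (abs_real_inner_le_norm q e)
    have : ‖q‖ * ‖e‖ ≤ N * ‖e‖ := by gcongr
    nlinarith [sq_nonneg ‖e‖]
  have b6 : m * t * (‖q‖ ^ 2 - 2 * N * ‖e‖) ≤ inner ℝ (q + e) G :=
    (mul_le_mul_of_nonneg_left b5 (by positivity)).trans b2
  have c1 := mul_le_mul_of_nonneg_left b1 hγ.le
  have c2 := mul_le_mul_of_nonneg_left b6 hγ.le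
  have c3 := mul_le_mul_of_nonneg_left b3 ht.le
  have c4 := mul_le_mul_of_nonneg_left b4 ht.le
  have c5 : 0 ≤ t ^ 2 * ‖q + e‖ ^ 2 / 2 := by positivity
  -- Single constant for all errors: the products missing from the actual estimate are added as the
  -- nonnegative terms `p1`–`p5`.
  have hfin : γ * (L * (t * N) * (t * N + (1 + γ * L) * (t * N) + ‖e‖))
      - γ * (m * t * (‖q‖ ^ 2 - 2 * N * ‖e‖)) + t * (N * ‖e‖) + t * (N * ((1 + γ * L) * (t * N)))
      + t * γ * L * N * t + t * (γ * L * N * ((2 + γ * L) * N)) * ‖e‖ + t * N * t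
      + t * ((1 + γ * L) * N ^ 2) * ‖e‖ + t * (2 * γ * m * N) * t
      = - t * (γ * m * ‖q‖ ^ 2)
        + t * (γ * L * N * (1 + (2 + γ * L) * N) + N + (1 + γ * L) * N ^ 2 + 2 * γ * m * N)
          * (‖e‖ + t) := by ring
  have p1 : 0 ≤ t * γ * L * N * t := by positivity
  have p2 : 0 ≤ t * (γ * L * N * ((2 + γ * L) * N)) * ‖e‖ := by positivity
  have p3 : 0 ≤ t * N * t := by positivity
  have p4 : 0 ≤ t * ((1 + γ * L) * N ^ 2) * ‖e‖ := by positivity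
  have p5 : 0 ≤ t * (2 * γ * m * N) * t := by positivity
  linarith

end IsStrongVI

end MetricProjection

/-! ### Lyapunov bounds, invariant balls and the distance of the filter to the hull. -/

section Tracking

/-- Discrete Grönwall inequality for a contraction towards `b`. -/
theorem le_of_contracting_recursion {u : ℕ → ℝ} {θ b : ℝ} (hθ : θ ≤ 1) (hb : 0 ≤ b)
    (hu : ∀ k, u (k + 1) ≤ (1 - θ) * u k + θ * b) (k : ℕ) :
    u k ≤ (1 - θ) ^ k * u 0 + b := by
  induction k with
  | zero => simp [hb]
  | succ k ih =>
    have := mul_le_mul_of_nonneg_left ih (sub_nonneg.2 hθ)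
    calc u (k + 1) ≤ (1 - θ) * ((1 - θ) ^ k * u 0 + b) + θ * b := (hu k).trans (by linarith)
      _ = _ := by ring

theorem one_sub_pow_le_exp {θ : ℝ} (hθ : θ ≤ 1) (k : ℕ) :
    (1 - θ) ^ k ≤ Real.exp (-(θ * k)) := by
  calc (1 - θ) ^ k ≤ Real.exp (-θ) ^ k :=
        pow_le_pow_left₀ (sub_nonneg.2 hθ) (Real.one_sub_le_exp_neg θ) k
    _ = _ := by rw [← Real.exp_nat_mul]; congr 1; ring

variable {E : Type*} [NormedAddCommGroup E] [InnerProductSpace ℝ E]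
  {F : E → E} {C : Set E} {π : E → E} {m L γ : ℝ}

/-- A relaxed step towards a point of `C` contracts the distance to `C`. -/
theorem IsMetricProjection.norm_relaxed_sub_le (hπ : IsMetricProjection C π) (hC : Convex ℝ C)
    (x : E) {p : E} (hp : p ∈ C) {t : ℝ} (h0 : 0 ≤ t) (h1 : t ≤ 1) :
    ‖((1 - t) • x + t • p) - π ((1 - t) • x + t • p)‖ ≤ (1 - t) * ‖x - π x‖ := by
  have hmem : (1 - t) • π x + t • p ∈ C := hC (hπ x).1 hp (sub_nonneg.2 h1) h0 (by ring)
  refine (hπ.norm_sub_le _ hmem).trans_eq ?_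
  rw [add_sub_add_right_eq_sub, ← smul_sub, norm_smul, Real.norm_of_nonneg (sub_nonneg.2 h1)]

namespace IsStrongVI

/-- On C the projection inequality makes the slack nonnegative. Off C it is tested at π x instead of
x, and the loss is at most linear plus quadratic in the infeasibility; this dictates the two penalty
weights used below. -/
theorem fbSlack_lower (h : IsStrongVI F C π m L γ) {G B : ℝ} (hG : ∀ y ∈ C, ‖F y‖ ≤ G)
    (hB : ∀ y ∈ C, ∀ z ∈ C, ‖y - z‖ ≤ B) (x : E) :
    0 ≤ fbSlack F π γ x + (γ * G + B) * ‖x - π x‖ + (γ * L + 1) * ‖x - π x‖ ^ 2 := by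
  have hp : π (x - γ • F x) = x + fbResidual F π γ x := by simp [fbResidual]
  have h1 := (h.proj (x - γ • F x)).2 _ (h.proj x).1
  have h2 := hB _ (h.proj (x - γ • F x)).1 _ (h.proj x).1
  have h3 := hG _ (h.proj x).1
  have h4 := h.lip x (π x)
  have hγ := h.γ_pos
  rw [hp] at h1 h2
  unfold fbSlack
  set q := fbResidual F π γ x
  set D := ‖x - π x‖
  have e1 : inner ℝ (x - γ • F x - (x + q)) (π x - (x + q))
      = inner ℝ (γ • F x + q) (x - π x) + inner ℝ (γ • F x + q) q := by
    rw [← inner_add_right, ← inner_neg_neg]; congr 1 <;> abel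
  rw [e1] at h1
  have e2 : q = (x + q - π x) - (x - π x) := by abel
  have b1 : ‖q‖ ≤ B + D := by
    rw [e2]; exact (_root_.norm_sub_le _ _).trans (by linarith)
  have b2 : ‖F x‖ ≤ G + L * D := by
    have : F x = F (π x) + (F x - F (π x)) := by abel
    rw [this]; exact (norm_add_le _ _).trans (by linarith)
  have b3 : ‖γ • F x + q‖ ≤ γ * (G + L * D) + (B + D) := by
    refine (norm_add_le _ _).trans ?_
    rw [norm_smul, Real.norm_of_nonneg hγ.le]
    gcongr
  have b4 := neg_le_of_abs_le (abs_real_inner_le_norm (γ • F x + q) (x - π x))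
  have b5 : ‖γ • F x + q‖ * D ≤ (γ * (G + L * D) + (B + D)) * D := by gcongr
  nlinarith

/-- The bound is linear, not quadratic, in r near the solution: F need not vanish at a constrained
solution, and the penalty has a linear part. -/
theorem gapLyapunov_upper (h : IsStrongVI F C π m L γ) {K₁ K₂ G r : ℝ} (hK₁ : 0 ≤ K₁)
    (hK₂ : 0 ≤ K₂) (hG : ∀ y ∈ C, ‖F y‖ ≤ G) {xs : E} (hxs : xs ∈ C)
    (hvi : ∀ y ∈ C, 0 ≤ inner ℝ (F xs) (y - xs)) {x : E} (hr : ‖x - xs‖ ≤ r) :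
    gapLyapunov F π γ K₁ K₂ x ≤ (γ * (G + L) * (2 + γ * L) + K₁ + K₂) * (r + r ^ 2) := by
  have hγ := h.γ_pos
  have hL := h.L_nonneg
  have hr0 : 0 ≤ r := (norm_nonneg _).trans hr
  have hG0 : 0 ≤ G := (norm_nonneg _).trans (hG xs hxs)
  have h1 : ‖x - π x‖ ≤ r := (h.proj.norm_sub_le x hxs).trans hr
  have h2 : ‖F x‖ ≤ G + L * r := by
    have : F x = F xs + (F x - F xs) := by abel
    rw [this]
    refine (norm_add_le _ _).trans ?_
    have := h.lip x xs
    have : L * ‖x - xs‖ ≤ L * r := by gcongr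
    linarith [hG xs hxs]
  have h3 : ‖fbResidual F π γ x‖ ≤ (2 + γ * L) * r := by
    have e : fbResidual F π γ x = (π (x - γ • F x) - π (xs - γ • F xs)) - (x - xs) := by
      rw [h.fb_eq_of_vi hxs hvi, fbResidual]; abel
    rw [e]
    refine (_root_.norm_sub_le _ _).trans ?_
    have := h.norm_fb_sub_le x xs
    have : (1 + γ * L) * ‖x - xs‖ ≤ (1 + γ * L) * r := by gcongr
    linarith
  have h4 : fbSlack F π γ x + ‖fbResidual F π γ x‖ ^ 2 / 2 ≤ γ * (G + L * r) * ((2 + γ * L) * r) := by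
    unfold fbSlack
    rw [inner_add_left, real_inner_self_eq_norm_sq, inner_smul_left, RCLike.conj_to_real]
    have := neg_le_of_abs_le (abs_real_inner_le_norm (F x) (fbResidual F π γ x))
    have h5 : ‖F x‖ * ‖fbResidual F π γ x‖ ≤ (G + L * r) * ((2 + γ * L) * r) := by gcongr
    nlinarith [sq_nonneg ‖fbResidual F π γ x‖]
  have h5 : K₁ * ‖x - π x‖ ≤ K₁ * r := by gcongr
  have h6 : K₂ * ‖x - π x‖ ^ 2 ≤ K₂ * r ^ 2 := by gcongr
  unfold gapLyapunov
  have h7 : γ * (G + L * r) * ((2 + γ * L) * r) ≤ γ * (G + L) * (2 + γ * L) * (r + r ^ 2) := by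
    have : (γ * (G + L * r) * ((2 + γ * L) * r)) + γ * (2 + γ * L) * (G * r ^ 2 + L * r)
       = γ * (G + L) * (2 + γ * L) * (r + r ^ 2) := by ring
    rw [← this]
    have : 0 ≤ γ * (2 + γ * L) * (G * r ^ 2 + L * r) := by positivity
    linarith
  nlinarith [mul_nonneg hK₁ (sq_nonneg r), mul_nonneg hK₂ hr0]

/-- The penalty shrinks by 1 - t because the step is relaxed towards a point of C, while the gap
loses t times the slack plus γm‖q‖². Together these dominate ct times the whole function. -/
theorem gapLyapunov_step (h : IsStrongVI F C π m L γ) (hC : Convex ℝ C) {G B : ℝ}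
    (hG : ∀ y ∈ C, ‖F y‖ ≤ G) (hB : ∀ y ∈ C, ∀ z ∈ C, ‖y - z‖ ≤ B) {c : ℝ}
    (hc1 : c ≤ 1) (hc2 : c ≤ 2 * γ * m) {x p : E} (hp : p ∈ C) {t N : ℝ} (ht : 0 < t)
    (ht1 : t ≤ 1) (hd : ‖p - x‖ ≤ N) (hq : ‖fbResidual F π γ x‖ ≤ N)
    (hF : ‖γ • F x + fbResidual F π γ x‖ ≤ N) :
    gapLyapunov F π γ (γ * G + B) (γ * L + 1) ((1 - t) • x + t • p) ≤
      (1 - c * t) * gapLyapunov F π γ (γ * G + B) (γ * L + 1) x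
        + t * (γ * L * N * (1 + (2 + γ * L) * N) + N + (1 + γ * L) * N ^ 2 + 2 * γ * m * N)
          * (‖p - π (x - γ • F x)‖ + t) := by
  have h1 := h.gap_step ht hd hq hF
  have e1 : x + t • (p - x) = (1 - t) • x + t • p := by module
  have e2 : p - x - fbResidual F π γ x = p - π (x - γ • F x) := by unfold fbResidual; abel
  rw [e1, e2] at h1
  have h2 := h.proj.norm_relaxed_sub_le hC x hp ht.le ht1
  have h3 := h.fbSlack_lower hG hB x
  unfold gapLyapunov
  set D' := ‖((1 - t) • x + t • p) - π ((1 - t) • x + t • p)‖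
  set D := ‖x - π x‖
  have hD : 0 ≤ D := norm_nonneg _
  have hD' : 0 ≤ D' := norm_nonneg _
  have hK1 : 0 ≤ γ * G + B :=
    add_nonneg (mul_nonneg h.γ_pos.le ((norm_nonneg _).trans (hG p hp)))
      ((norm_nonneg _).trans (hB p hp p hp))
  have hK2 : 0 ≤ γ * L + 1 := by have := h.γ_pos; have := h.L_nonneg; positivity
  have b1 : (γ * G + B) * D' ≤ (1 - t) * ((γ * G + B) * D) := by nlinarith
  have b2 : (γ * L + 1) * D' ^ 2 ≤ (1 - t) * ((γ * L + 1) * D ^ 2) := by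
    have : D' ^ 2 ≤ (1 - t) * D ^ 2 := by
      calc D' ^ 2 ≤ ((1 - t) * D) ^ 2 := by gcongr
        _ ≤ (1 - t) * D ^ 2 := by nlinarith [mul_nonneg (sub_nonneg.2 ht1) (sq_nonneg D)]
    nlinarith
  -- `c ≤ 1` leaves a nonnegative share of slack plus penalty, and in `b4` `c ≤ 2γm` leaves one of
  -- the squared residual.
  have b3 : 0 ≤ (1 - c) * t * (fbSlack F π γ x + (γ * G + B) * D + (γ * L + 1) * D ^ 2) :=
    mul_nonneg (mul_nonneg (sub_nonneg.2 hc1) ht.le) h3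
  have b4 : 0 ≤ t * (γ * m - c / 2) * ‖fbResidual F π γ x‖ ^ 2 :=
    mul_nonneg (mul_nonneg ht.le (by linarith)) (sq_nonneg _)
  linarith

theorem norm_sub_sq_le_gapLyapunov (h : IsStrongVI F C π m L γ) {G B : ℝ}
    (hG : ∀ y ∈ C, ‖F y‖ ≤ G) (hB : ∀ y ∈ C, ∀ z ∈ C, ‖y - z‖ ≤ B) {xs : E} (hxs : xs ∈ C)
    (hvi : ∀ y ∈ C, 0 ≤ inner ℝ (F xs) (y - xs)) (x : E) :
    ‖x - xs‖ ^ 2 ≤ 2 * ((1 + γ * L) / (γ * m)) ^ 2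
      * gapLyapunov F π γ (γ * G + B) (γ * L + 1) x := by
  have h1 := h.error_bound hxs hvi x
  have h3 := h.fbSlack_lower hG hB x
  have hγm : 0 < γ * m := mul_pos h.γ_pos h.m_pos
  have h2 : ‖x - xs‖ ≤ (1 + γ * L) / (γ * m) * ‖fbResidual F π γ x‖ := by
    rw [div_mul_eq_mul_div, le_div_iff₀ hγm]; linarith
  calc ‖x - xs‖ ^ 2 ≤ ((1 + γ * L) / (γ * m) * ‖fbResidual F π γ x‖) ^ 2 := by gcongr
    _ = 2 * ((1 + γ * L) / (γ * m)) ^ 2 * (‖fbResidual F π γ x‖ ^ 2 / 2) := by ring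
    _ ≤ _ := by
      refine mul_le_mul_of_nonneg_left ?_ (by positivity)
      unfold gapLyapunov; linarith

/-- Iterates of the relaxed scheme stay in a ball. -/
theorem norm_iterate_sub_le {C : Set E} {B r : ℝ} {xs : E} (hB : ∀ y ∈ C, ‖y - xs‖ ≤ B)
    {t : ℝ} (ht0 : 0 ≤ t) (ht1 : t ≤ 1) {x p : ℕ → E} (hp : ∀ k, p k ∈ C)
    (hx : ∀ k, x (k + 1) = (1 - t) • x k + t • p k) (h0 : ‖x 0 - xs‖ ≤ r) (hr : B ≤ r) (k : ℕ) :
    ‖x k - xs‖ ≤ r := by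
  induction k with
  | zero => exact h0
  | succ k ih =>
    have e : x (k + 1) - xs = (1 - t) • (x k - xs) + t • (p k - xs) := by rw [hx]; module
    rw [e]
    refine (norm_add_le _ _).trans ?_
    rw [norm_smul, norm_smul, Real.norm_of_nonneg ht0, Real.norm_of_nonneg (sub_nonneg.2 ht1)]
    nlinarith [hB _ (hp k), mul_le_mul_of_nonneg_left ih (sub_nonneg.2 ht1),
      mul_le_mul_of_nonneg_left ((hB _ (hp k)).trans hr) ht0]

/-- The filter state stays close to the closed convex hull of the image of the feasible set. -/
theorem exists_hull_near (h : IsStrongVI F C π m L γ) (hC : Convex ℝ C) {xs : E} (hxs : xs ∈ C)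
    {α β r b : ℝ} (hα0 : 0 < α) (hα1 : α ≤ 1) (hβ0 : 0 < β) (hβ1 : β ≤ 1 / 2)
    {x χ p : ℕ → E} (hp : ∀ k, p k ∈ C)
    (hx : ∀ k, x (k + 1) = (1 - α * β) • x k + (α * β) • p k)
    (hχ : ∀ k, ‖χ (k + 1) - ((1 - α) • χ k + α • F (x k))‖ ≤ α * b)
    (hx0 : ‖x 0 - xs‖ ≤ r) {c₀ : E} (hc₀ : c₀ ∈ closure (convexHull ℝ (F '' C)))
    (hχ0 : ‖χ 0 - c₀‖ ≤ r + b) (k : ℕ) :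
    ∃ c ∈ closure (convexHull ℝ (F '' C)),
      ‖χ k - c‖ ≤ (2 * L + 1) * r * (1 - α * β) ^ k + b := by
  have hL := h.L_nonneg
  have hr : 0 ≤ r := (norm_nonneg _).trans hx0
  have hαβ : α * β ≤ 1 := by nlinarith
  -- Infeasibility decays geometrically whatever points of C are aimed at, so this needs no accuracy
  -- of the filter.
  have hD : ∀ k, ‖x k - π (x k)‖ ≤ (1 - α * β) ^ k * r := by
    intro k
    induction k with
    | zero => simpa using (h.proj.norm_sub_le _ hxs).trans hx0
    | succ k ih =>
      rw [hx]
      refine (h.proj.norm_relaxed_sub_le hC (x k) (hp k) (by positivity) hαβ).trans ?_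
      rw [pow_succ']
      nlinarith [mul_le_mul_of_nonneg_left ih (sub_nonneg.2 hαβ)]
  induction k with
  | zero =>
    refine ⟨c₀, hc₀, hχ0.trans ?_⟩
    rw [pow_zero, mul_one]; nlinarith [mul_nonneg hL hr]
  | succ k ih =>
    obtain ⟨c, hc, hck⟩ := ih
    have hcF : F (π (x k)) ∈ closure (convexHull ℝ (F '' C)) :=
      subset_closure (subset_convexHull ℝ _ ⟨_, (h.proj _).1, rfl⟩)
    -- The hull point runs through the same filter, driven by F at the projected iterate; convexity
    -- keeps it in the hull.
    refine ⟨(1 - α) • c + α • F (π (x k)),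
      (convex_convexHull ℝ _).closure hc hcF (sub_nonneg.2 hα1) hα0.le (by ring), ?_⟩
    have e : χ (k + 1) - ((1 - α) • c + α • F (π (x k)))
        = (1 - α) • (χ k - c) + α • (F (x k) - F (π (x k)))
          + (χ (k + 1) - ((1 - α) • χ k + α • F (x k))) := by module
    rw [e]
    refine norm_add₃_le.trans ?_
    rw [norm_smul, norm_smul, Real.norm_of_nonneg hα0.le, Real.norm_of_nonneg (sub_nonneg.2 hα1)]
    set P := (1 - α * β) ^ k with hP
    have hP0 : 0 ≤ P := pow_nonneg (sub_nonneg.2 hαβ) k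
    have h1 := mul_le_mul_of_nonneg_left hck (sub_nonneg.2 hα1)
    have h2 : α * ‖F (x k) - F (π (x k))‖ ≤ α * (L * (P * r)) := by
      have := (h.lip (x k) (π (x k))).trans (mul_le_mul_of_nonneg_left (hD k) hL)
      gcongr
    have h3 := hχ k
    -- With the factor 2L + 1 and β ≤ 1/2, the fast filter absorbs an input that decays only at the
    -- slow rate.
    have h4 : 0 ≤ α * r * P * (L + 1 - β * (2 * L + 1)) := by
      have : 0 ≤ L + 1 - β * (2 * L + 1) := by nlinarith
      positivity
    rw [pow_succ', ← hP]
    nlinarith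

end IsStrongVI

end Tracking

/-! ### The combined slow-fast Lyapunov estimate. -/

section Tracking

variable {E : Type*} [NormedAddCommGroup E] [InnerProductSpace ℝ E]
  {F : E → E} {C : Set E} {π : E → E} {m L γ : ℝ}

theorem norm_le_of_mem_closure_convexHull {S : Set E} {G : ℝ} (hG : ∀ y ∈ S, ‖y‖ ≤ G) {c : E}
    (hc : c ∈ closure (convexHull ℝ S)) : ‖c‖ ≤ G := by
  have h1 : convexHull ℝ S ⊆ Metric.closedBall 0 G :=
    convexHull_min (fun y hy => by simpa using hG y hy) (convex_closedBall _ _)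
  simpa using closure_minimal h1 Metric.isClosed_closedBall hc

namespace IsStrongVI

set_option maxHeartbeats 1000000 in
/-- The decision variables converge exponentially, in the slow time, up to a practical error. -/
theorem exists_norm_sub_sq_bound (h : IsStrongVI F C π m L γ) (hC : Convex ℝ C) {G B : ℝ}
    (hG : ∀ y ∈ C, ‖F y‖ ≤ G) (hB : ∀ y ∈ C, ∀ z ∈ C, ‖y - z‖ ≤ B) {xs : E} (hxs : xs ∈ C)
    (hvi : ∀ y ∈ C, 0 ≤ inner ℝ (F xs) (y - xs)) :
    ∃ c > 0, c ≤ 1 ∧ ∃ K₀ ≥ 0, ∀ R, B ≤ R → ∃ K ≥ 0, ∀ β, 0 < β → β ≤ 1 / 2 →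
      ∀ α, 0 < α → α ≤ 1 → ∀ (r : ℝ) (x ξ χ : ℕ → E) (c₀ : E), r ≤ R →
        (∀ k, x (k + 1) = (1 - α * β) • x k + (α * β) • π (x k - γ • ξ k)) →
        (∀ k, ‖ξ k - χ k‖ ≤ β) →
        (∀ k, ‖χ (k + 1) - ((1 - α) • χ k + α • F (x k))‖ ≤ α * β) →
        ‖x 0 - xs‖ ≤ r → c₀ ∈ closure (convexHull ℝ (F '' C)) → ‖χ 0 - c₀‖ ≤ r + β →
        ∀ k : ℕ, ‖x k - xs‖ ^ 2 ≤
          K₀ * (r + r ^ 2) * Real.exp (-(c * (α * β * k))) + K * β := by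
  have hγ := h.γ_pos
  have hL := h.L_nonneg
  have hm := h.m_pos
  have hG0 : 0 ≤ G := (norm_nonneg _).trans (hG xs hxs)
  have hB0 : 0 ≤ B := (norm_nonneg _).trans (hB xs hxs xs hxs)
  set c := min 1 (2 * γ * m) with hc
  have hc0 : 0 < c := by rw [hc]; positivity
  have hc1 : c ≤ 1 := min_le_left _ _
  have hc2 : c ≤ 2 * γ * m := min_le_right _ _
  set T := 2 * ((1 + γ * L) / (γ * m)) ^ 2 with hT
  set K₃ := γ * (G + L) * (2 + γ * L) + (γ * G + B) + (γ * L + 1) with hK₃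
  have hT0 : 0 ≤ T := by positivity
  have hK₃0 : 0 ≤ K₃ := by positivity
  -- The rate and the transient gain are fixed before R, so the final 𝒦ℒ function does not depend on
  -- Δ; only the residual constant K does.
  refine ⟨c, hc0, hc1, T * K₃, by positivity, fun R hR => ?_⟩
  have hR0 : 0 ≤ R := hB0.trans hR
  -- Bounds the direction, the residual and γF plus the residual on the ball of radius R around the
  -- solution.
  set N := γ * (G + L * R) + B + R with hN
  have hN0 : 0 ≤ N := by positivity
  set Mc := γ * L * N * (1 + (2 + γ * L) * N) + N + (1 + γ * L) * N ^ 2 + 2 * γ * m * N with hMc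
  have hMc0 : 0 ≤ Mc := by positivity
  set S := Mc * (γ + 1) + 2 * Mc * γ * (1 + L * N) with hS
  have hS0 : 0 ≤ S := by positivity
  refine ⟨T * (S / c + 2 * Mc * γ * ((R + 1) + G + (G + L * R))), by positivity, ?_⟩
  intro β hβ0 hβ1 α hα0 hα1 r x ξ χ c₀ hrR hx hξ hχ hx0 hc₀ hχ0 k
  have hr0 : 0 ≤ r := (norm_nonneg _).trans hx0
  have ht0 : 0 < α * β := by positivity
  have htβ : α * β ≤ β := mul_le_of_le_one_left hβ0.le hα1
  have ht1 : α * β ≤ 1 := htβ.trans (hβ1.trans (by norm_num))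
  have hct0 : 0 ≤ c * (α * β) := by positivity
  have hct1 : c * (α * β) ≤ 1 := mul_le_one₀ hc1 ht0.le ht1
  have hcβ : c * β ≤ 1 / 2 := (mul_le_of_le_one_left hβ0.le hc1).trans hβ1
  have hball : ∀ k, ‖x k - xs‖ ≤ R :=
    norm_iterate_sub_le (fun y hy => hB y hy xs hxs) ht0.le ht1 (fun k => (h.proj _).1) hx
      (hx0.trans hrR) hR
  have hFx : ∀ k, ‖F (x k)‖ ≤ G + L * R := by
    intro k
    have e : F (x k) = F xs + (F (x k) - F xs) := by abel
    rw [e]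
    refine (norm_add_le _ _).trans (add_le_add (hG xs hxs) ((h.lip _ _).trans ?_))
    exact mul_le_mul_of_nonneg_left (hball k) hL
  have hd : ∀ k, ∀ p ∈ C, ‖p - x k‖ ≤ B + R := by
    intro k p hp
    have e : p - x k = (p - xs) - (x k - xs) := by abel
    rw [e]
    exact (_root_.norm_sub_le _ _).trans (add_le_add (hB p hp xs hxs) (hball k))
  have hGR : 0 ≤ γ * (G + L * R) := by positivity
  set V := fun k => gapLyapunov F π γ (γ * G + B) (γ * L + 1) (x k) with hV
  set W := fun k => ‖χ k - F (x k)‖ with hW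
  have hVstep : ∀ k, V (k + 1) ≤ (1 - c * (α * β)) * V k
      + α * β * Mc * (γ * (β + W k) + α * β) := by
    intro k
    have h1 := h.gapLyapunov_step hC hG hB hc1 hc2 (x := x k) (h.proj (x k - γ • ξ k)).1 ht0 ht1
      (N := N) ((hd k _ (h.proj _).1).trans (by linarith))
      ((hd k _ (h.proj _).1).trans (by linarith))
      ((norm_add_le _ _).trans (by
        rw [norm_smul, Real.norm_of_nonneg hγ.le]
        have h1 : ‖fbResidual F π γ (x k)‖ ≤ B + R := hd k _ (h.proj _).1
        have := mul_le_mul_of_nonneg_left (hFx k) hγ.le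
        linarith))
    rw [← hx] at h1
    refine h1.trans (add_le_add_right ?_ _)
    refine mul_le_mul_of_nonneg_left (add_le_add_left ?_ _) (by positivity)
    refine (h.proj.norm_map_sub_le _ _).trans ?_
    have e : x k - γ • ξ k - (x k - γ • F (x k)) = -(γ • ((ξ k - χ k) + (χ k - F (x k)))) := by
      module
    rw [e, norm_neg, norm_smul, Real.norm_of_nonneg hγ.le]
    exact mul_le_mul_of_nonneg_left ((norm_add_le _ _).trans (add_le_add_left (hξ k) _)) hγ.le
  have hWstep : ∀ k, W (k + 1) ≤ (1 - α) * W k + α * β * (1 + L * N) := by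
    intro k
    have e : χ (k + 1) - F (x (k + 1)) = (1 - α) • (χ k - F (x k))
        + (χ (k + 1) - ((1 - α) • χ k + α • F (x k))) + (F (x k) - F (x (k + 1))) := by module
    have e2 : x k - x (k + 1) = -((α * β) • (π (x k - γ • ξ k) - x k)) := by rw [hx]; module
    have h1 := h.lip (x k) (x (k + 1))
    rw [e2, norm_neg, norm_smul, Real.norm_of_nonneg ht0.le] at h1
    have h2 := hd k _ (h.proj (x k - γ • ξ k)).1
    have h3 : L * (α * β * ‖π (x k - γ • ξ k) - x k‖) ≤ L * (α * β * N) := by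
      gcongr; linarith
    simp only [hW]
    rw [e]
    refine norm_add₃_le.trans ?_
    rw [norm_smul, Real.norm_of_nonneg (sub_nonneg.2 hα1)]
    linarith [hχ k]
  have hW0 : W 0 ≤ (R + 1) + G + (G + L * R) := by
    have e : χ 0 - F (x 0) = (χ 0 - c₀) + c₀ + (-F (x 0)) := by abel
    simp only [hW]
    rw [e]
    refine norm_add₃_le.trans ?_
    rw [norm_neg]
    have := norm_le_of_mem_closure_convexHull (S := F '' C) (G := G)
      (by rintro _ ⟨y, hy, rfl⟩; exact hG y hy) hc₀
    linarith [hFx 0]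
  have hV0 : V 0 ≤ K₃ * (r + r ^ 2) :=
    h.gapLyapunov_upper (by positivity) (by positivity) hG hxs hvi hx0
  have hWnn : ∀ k, 0 ≤ W k := fun k => norm_nonneg _
  -- The weight 2βMcγ makes the decay αW of the tracking error twice its contribution to the step of
  -- V. Half cancels that contribution; the other half (`h4`, from cβ ≤ 1/2) gives the slow
  -- contraction. As the weight is O(β), so is the cost of `W 0`.
  have hQ := le_of_contracting_recursion (u := fun k => V k + 2 * β * Mc * γ * W k)
    (θ := c * (α * β)) (b := β * (S / c)) hct1 (by positivity) (by
      intro k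
      have h1 := hVstep k
      have h2 := mul_le_mul_of_nonneg_left (hWstep k)
        (show 0 ≤ 2 * β * Mc * γ by positivity)
      have h3 : c * (α * β) * (β * (S / c)) = α * β * β * S := by field_simp
      have h4 : 0 ≤ β * Mc * γ * α * W k * (1 - 2 * c * β) := by
        have := hWnn k
        have : 0 ≤ 1 - 2 * c * β := by linarith
        positivity
      have h5 : α * β * Mc * (α * β) ≤ α * β * Mc * β :=
        mul_le_mul_of_nonneg_left htβ (by positivity)
      rw [h3, hS]
      linarith) k
  have hexp := one_sub_pow_le_exp (θ := c * (α * β)) hct1 k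
  have hVk : V k ≤ K₃ * (r + r ^ 2) * Real.exp (-(c * (α * β * k)))
      + (S / c + 2 * Mc * γ * ((R + 1) + G + (G + L * R))) * β := by
    have h1 : 0 ≤ 2 * β * Mc * γ * W k := by have := hWnn k; positivity
    have hp0 : 0 ≤ (1 - c * (α * β)) ^ k := pow_nonneg (sub_nonneg.2 hct1) k
    have hp1 : (1 - c * (α * β)) ^ k ≤ 1 := pow_le_one₀ (sub_nonneg.2 hct1) (by linarith)
    have h2 : (1 - c * (α * β)) ^ k * V 0 ≤
        K₃ * (r + r ^ 2) * Real.exp (-(c * (α * β * k))) := by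
      rw [mul_assoc] at hexp
      calc (1 - c * (α * β)) ^ k * V 0 ≤ (1 - c * (α * β)) ^ k * (K₃ * (r + r ^ 2)) := by gcongr
        _ ≤ Real.exp (-(c * (α * β * k))) * (K₃ * (r + r ^ 2)) := by gcongr
        _ = _ := by ring
    have h3 : (1 - c * (α * β)) ^ k * (2 * β * Mc * γ * W 0) ≤
        2 * β * Mc * γ * ((R + 1) + G + (G + L * R)) := by
      have hw := hWnn 0
      calc (1 - c * (α * β)) ^ k * (2 * β * Mc * γ * W 0) ≤ 1 * (2 * β * Mc * γ * W 0) := by gcongr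
        _ ≤ _ := by rw [one_mul]; gcongr
    simp only [mul_add] at hQ h3 ⊢
    linarith
  calc ‖x k - xs‖ ^ 2 ≤ T * V k := h.norm_sub_sq_le_gapLyapunov hG hB hxs hvi (x k)
    _ ≤ T * _ := mul_le_mul_of_nonneg_left hVk hT0
    _ = _ := by ring

end IsStrongVI

end Tracking

/-! ### Averaging of the zeroth-order estimate by summation by parts. -/

section Averaging

/-- The partial sums of `t` (up to a constant) are bounded by `B`. -/
def HasBoundedPrimitive (B : ℝ) (t : ℕ → ℝ) : Prop :=
  ∃ S : ℕ → ℝ, (∀ k, |S k| ≤ B) ∧ ∀ k, S (k + 1) - S k = t k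

theorem HasBoundedPrimitive.mono {B B' : ℝ} {t : ℕ → ℝ} (h : HasBoundedPrimitive B t)
    (hB : B ≤ B') : HasBoundedPrimitive B' t :=
  let ⟨S, h1, h2⟩ := h
  ⟨S, fun k => (h1 k).trans hB, h2⟩

theorem HasBoundedPrimitive.half_add {B B' : ℝ} {t s : ℕ → ℝ} (ht : HasBoundedPrimitive B t)
    (hs : HasBoundedPrimitive B' s) :
    HasBoundedPrimitive (B + B') (fun k => (t k + s k) / 2) := by
  obtain ⟨S, h1, h2⟩ := ht
  obtain ⟨S', h1', h2'⟩ := hs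
  refine ⟨fun k => (S k + S' k) / 2, fun k => ?_, fun k => ?_⟩
  · have := abs_le.1 (h1 k); have := abs_le.1 (h1' k)
    rw [abs_le]; constructor <;> linarith
  · beta_reduce; rw [← h2, ← h2']; ring

/-- The cosine sum telescopes after multiplication by 2 sin(w/2), which is nonzero exactly off
resonance. The bound is uniform in the phase. -/
theorem exists_hasBoundedPrimitive_cos {w : ℝ} (hw : ∀ n : ℤ, w ≠ 2 * Real.pi * n) :
    ∃ B, 0 ≤ B ∧ ∀ φ, HasBoundedPrimitive B (fun k : ℕ => Real.cos (φ + k * w)) := by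
  have hs : Real.sin (w / 2) ≠ 0 := by
    rw [Ne, Real.sin_eq_zero_iff]
    rintro ⟨n, hn⟩
    exact hw n (by linarith)
  refine ⟨|1 / (2 * Real.sin (w / 2))|, abs_nonneg _, fun φ =>
    ⟨fun k => 1 / (2 * Real.sin (w / 2)) * Real.sin (φ + k * w - w / 2), fun k => ?_, fun k => ?_⟩⟩
  · rw [abs_mul]
    exact mul_le_of_le_one_right (abs_nonneg _) (Real.abs_sin_le_one _)
  · have e1 : φ + ((k + 1 : ℕ) : ℝ) * w - w / 2 = (φ + k * w) + w / 2 := by push_cast; ring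
    beta_reduce
    rw [e1, Real.sin_add, Real.sin_sub]
    field_simp
    ring

theorem exists_modulus {E F : Type*} [NormedAddCommGroup E] [ProperSpace E] [NormedAddCommGroup F]
    {g : E → F} (hg : Continuous g) (R : ℝ) {ε : ℝ} (hε : 0 < ε) :
    ∃ δ > 0, ∀ x y, ‖x‖ ≤ R → ‖y‖ ≤ R → ‖x - y‖ ≤ δ → ‖g x - g y‖ ≤ ε := by
  have h := (isCompact_closedBall (0 : E) R).uniformContinuousOn_of_continuous hg.continuousOn
  obtain ⟨δ, hδ, h⟩ := Metric.uniformContinuousOn_iff_le.1 h ε hε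
  refine ⟨δ, hδ, fun x y hx hy hxy => ?_⟩
  simpa [dist_eq_norm] using h x (by simpa using hx) y (by simpa using hy)
    (by simpa [dist_eq_norm] using hxy)

theorem exists_norm_bound {E F : Type*} [NormedAddCommGroup E] [ProperSpace E]
    [NormedAddCommGroup F] {g : E → F} (hg : Continuous g) (R : ℝ) :
    ∃ b, 0 ≤ b ∧ ∀ x, ‖x‖ ≤ R → ‖g x‖ ≤ b := by
  obtain ⟨b, hb⟩ := (isCompact_closedBall (0 : E) R).exists_bound_of_continuousOn hg.continuousOn
  exact ⟨max b 0, le_max_right _ _, fun x hx => (hb x (by simpa using hx)).trans (le_max_left _ _)⟩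

variable {E : Type*} [NormedAddCommGroup E] [NormedSpace ℝ E] [ProperSpace E]
  {ι : Type*} [Fintype ι] [DecidableEq ι]

/-- The zeroth-order estimate of a partial derivative is close to it up to a coboundary whose
potential is bounded for fixed amplitudes. -/
theorem exists_corrector {f : E → ℝ} (hf : ContDiff ℝ 1 f) {e : ι → E} (he : ∀ p, ‖e p‖ ≤ 1)
    (j : ι) {ρ B : ℝ} (hρ : 0 ≤ ρ) (hB : 0 ≤ B) (R R₁ : ℝ) {σ : ℝ} (hσ : 0 < σ) :
    ∃ amax > 0, ∀ a : ι → ℝ, (∀ p, 0 < a p) → (∀ p q, a p ≤ ρ * a q) → (∀ p, a p < amax) →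
      ∃ αmax > 0, ∀ α, 0 < α → α < αmax → ∀ (x : ℕ → E) (t : ℕ → ι → ℝ),
        (∀ k, ‖x k‖ ≤ R) → (∀ k, ‖x (k + 1) - x k‖ ≤ α * R₁) → (∀ k p, |t k p| ≤ 1) →
        HasBoundedPrimitive B (fun k => t k j) →
        (∀ p, HasBoundedPrimitive B (fun k => t k j * t k p - if j = p then 1 / 2 else 0)) →
        ∃ P : ℕ → ℝ, (∀ k, |α * P k| ≤ σ) ∧
          ∀ k, |P (k + 1) - P k - (2 / a j * f (x k + ∑ p, (a p * t k p) • e p) * t k j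
            - fderiv ℝ f (x k) (e j))| ≤ σ := by
  have hDf : Continuous (fderiv ℝ f) := hf.continuous_fderiv one_ne_zero
  have hdiff : Differentiable ℝ f := hf.differentiable one_ne_zero
  set n : ℝ := (Fintype.card ι : ℝ) with hn
  have hn0 : 0 ≤ n := Nat.cast_nonneg _
  -- This modulus fixes the amplitude threshold. The costs are only C¹, so the Taylor remainder is
  -- o(a) without a rate; the radius R + 1 leaves room for the dither.
  obtain ⟨δ, hδ, hmod⟩ := exists_modulus hDf (R + 1)
    (show 0 < σ / (4 * (n * ρ + 1)) by positivity)
  set ε := σ / (4 * (n * ρ + 1)) with hε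
  refine ⟨min δ 1 / (n + 1), by positivity, fun a ha haρ hasmall => ?_⟩
  have haj := ha j
  obtain ⟨Mf, hMf0, hMf⟩ := exists_norm_bound hf.continuous R
  obtain ⟨MD, hMD0, hMD⟩ := exists_norm_bound hDf R
  -- Chosen after the amplitudes, so the factor 2/a is harmless: the increments of f and its
  -- derivative along one step are made small through α.
  set ε₂ := σ / (2 * (2 / a j * B + n * (2 * ρ * B) + 1)) with hε₂
  have hε₂0 : 0 < ε₂ := by positivity
  obtain ⟨δf, hδf, hmodf⟩ := exists_modulus hf.continuous R hε₂0
  obtain ⟨δD, hδD, hmodD⟩ := exists_modulus hDf R hε₂0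
  set b := 2 / a j * Mf * B + n * (2 * ρ * MD * B) with hb
  have hb0 : 0 ≤ b := by positivity
  refine ⟨min (min δf δD / (|R₁| + 1)) (σ / (b + 1)), by positivity, ?_⟩
  intro α hα hαlt x t hx hdx ht hS hSS
  obtain ⟨S, hSB, hSt⟩ := hS
  choose T hTB hTt using hSS
  beta_reduce at hSt hTt
  have hdx' : ∀ k, ‖x (k + 1) - x k‖ ≤ min δf δD := by
    intro k
    have h1 : α < min δf δD / (|R₁| + 1) := hαlt.trans_le (min_le_left _ _)
    rw [lt_div_iff₀ (by positivity)] at h1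
    have h2 : α * R₁ ≤ α * (|R₁| + 1) :=
      mul_le_mul_of_nonneg_left (by linarith [le_abs_self R₁]) hα.le
    exact (hdx k).trans (h2.trans h1.le)
  have hratio : ∀ p, a p / a j ≤ ρ := fun p => (div_le_iff₀ haj).2 (haρ p j)
  have hcoef : ∀ (p : ι) (A : E →L[ℝ] ℝ) (s : ℝ), |s| ≤ B →
      |2 * (a p / a j) * A (e p) * s| ≤ 2 * ρ * ‖A‖ * B := by
    intro p A s hs
    have h1 : |A (e p)| ≤ ‖A‖ := (A.le_of_opNorm_le_of_le le_rfl (he p)).trans_eq (mul_one _)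
    have h2 : 0 ≤ a p / a j := (div_pos (ha p) haj).le
    rw [abs_mul, abs_mul, abs_mul, abs_of_nonneg h2, abs_two]
    have := hratio p
    gcongr
  -- The corrector: each oscillating factor of the first-order expansion is replaced by its bounded
  -- primitive, with the slow coefficients frozen at `x k`.
  refine ⟨fun k => 2 / a j * f (x k) * S k
    + ∑ p, 2 * (a p / a j) * fderiv ℝ f (x k) (e p) * T p k, fun k => ?_, fun k => ?_⟩
  · have h1 : |2 / a j * f (x k) * S k| ≤ 2 / a j * Mf * B := by
      rw [abs_mul, abs_mul, abs_of_pos (show 0 < 2 / a j by positivity)]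
      have := hMf _ (hx k); rw [Real.norm_eq_abs] at this
      have := hSB k
      gcongr
    have h2 : |∑ p, 2 * (a p / a j) * fderiv ℝ f (x k) (e p) * T p k| ≤ n * (2 * ρ * MD * B) := by
      refine (Finset.abs_sum_le_sum_abs _ _).trans ?_
      refine (Finset.sum_le_card_nsmul _ _ (2 * ρ * MD * B) fun p _ => ?_).trans_eq (by
        rw [nsmul_eq_mul, Finset.card_univ])
      refine (hcoef p _ _ (hTB p k)).trans ?_
      have := hMD _ (hx k)
      gcongr
    have h3 := (abs_add_le (2 / a j * f (x k) * S k)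
      (∑ p, 2 * (a p / a j) * fderiv ℝ f (x k) (e p) * T p k)).trans (add_le_add h1 h2)
    have h4 : α < σ / (b + 1) := hαlt.trans_le (min_le_right _ _)
    rw [lt_div_iff₀ (by positivity)] at h4
    rw [abs_mul, abs_of_pos hα]
    have := mul_le_mul_of_nonneg_left h3 hα.le
    linarith
  · set v := ∑ p, (a p * t k p) • e p with hv
    have hterm : ∀ p, ‖(a p * t k p) • e p‖ ≤ a p := by
      intro p
      rw [norm_smul, Real.norm_eq_abs, abs_mul, abs_of_pos (ha p), mul_assoc]
      exact mul_le_of_le_one_right (ha p).le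
        (mul_le_one₀ (ht k p) (norm_nonneg _) (he p))
    have hv1 : ‖v‖ ≤ n * (ρ * a j) := by
      refine (norm_sum_le_of_le _ fun p _ => (hterm p).trans (haρ p j)).trans_eq ?_
      simp [hn]
    have hv2 : ‖v‖ ≤ min δ 1 := by
      refine (norm_sum_le_of_le _ fun p _ => (hterm p).trans (hasmall p).le).trans ?_
      rw [Finset.sum_const, nsmul_eq_mul, Finset.card_univ, ← hn, mul_div_assoc']
      rw [div_le_iff₀ (by positivity)]
      have : 0 ≤ min δ 1 := by positivity
      linarith
    have htaylor : |f (x k + v) - f (x k) - fderiv ℝ f (x k) v| ≤ ε * ‖v‖ := by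
      have hconv : Convex ℝ (Metric.closedBall (x k) ‖v‖) := convex_closedBall _ _
      have := hconv.norm_image_sub_le_of_norm_fderiv_le' (𝕜 := ℝ) (f := f)
        (φ := fderiv ℝ f (x k)) (C := ε) (x := x k) (y := x k + v)
        (fun y _ => hdiff y) (fun y hy => ?_) (by simp) (by simp)
      · simpa using this
      · rw [mem_closedBall_iff_norm] at hy
        refine hmod _ _ ?_ ?_ (hy.trans (hv2.trans (min_le_left _ _)))
        · have e1 : y = (y - x k) + x k := by abel
          rw [e1]
          have := hv2.trans (min_le_right _ _)
          exact (norm_add_le _ _).trans (by linarith [hx k])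
        · linarith [hx k]
    have hlin : fderiv ℝ f (x k) v = ∑ p, a p * t k p * fderiv ℝ f (x k) (e p) := by
      rw [hv, map_sum]; simp
    -- Discrete product rule: what remains is the increments of the slow coefficients times the
    -- primitives, and the Taylor remainder. The diagonal mean 1/2 of t_j² yields exactly the
    -- partial derivative.
    have hmain : 2 / a j * f (x (k + 1)) * S (k + 1)
          + ∑ p, 2 * (a p / a j) * fderiv ℝ f (x (k + 1)) (e p) * T p (k + 1)
        - (2 / a j * f (x k) * S k + ∑ p, 2 * (a p / a j) * fderiv ℝ f (x k) (e p) * T p k)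
        - (2 / a j * f (x k + v) * t k j - fderiv ℝ f (x k) (e j))
        = 2 / a j * (f (x (k + 1)) - f (x k)) * S (k + 1)
          + ∑ p, 2 * (a p / a j) * (fderiv ℝ f (x (k + 1)) - fderiv ℝ f (x k)) (e p) * T p (k + 1)
          - 2 / a j * (f (x k + v) - f (x k) - fderiv ℝ f (x k) v) * t k j := by
      have h1 : ∑ p, 2 * (a p / a j) * fderiv ℝ f (x k) (e p) * (T p (k + 1) - T p k)
          = 2 / a j * fderiv ℝ f (x k) v * t k j - fderiv ℝ f (x k) (e j) := by
        rw [hlin, Finset.mul_sum, Finset.sum_mul]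
        have h2 : fderiv ℝ f (x k) (e j) =
            ∑ p, if j = p then fderiv ℝ f (x k) (e p) else 0 := by simp
        rw [h2, ← Finset.sum_sub_distrib]
        refine Finset.sum_congr rfl fun p _ => ?_
        rw [hTt]
        split_ifs with hjp
        · subst hjp; field_simp
        · field_simp; ring
      have h2 : ∑ p, 2 * (a p / a j) * (fderiv ℝ f (x (k + 1)) - fderiv ℝ f (x k)) (e p)
            * T p (k + 1)
          = ∑ p, 2 * (a p / a j) * fderiv ℝ f (x (k + 1)) (e p) * T p (k + 1)
            - ∑ p, 2 * (a p / a j) * fderiv ℝ f (x k) (e p) * T p k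
            - ∑ p, 2 * (a p / a j) * fderiv ℝ f (x k) (e p) * (T p (k + 1) - T p k) := by
        rw [← Finset.sum_sub_distrib, ← Finset.sum_sub_distrib]
        refine Finset.sum_congr rfl fun p _ => ?_
        rw [_root_.sub_apply]; ring
      rw [h2, h1]
      linear_combination (2 / a j * f (x k)) * hSt k
    rw [hmain]
    have b1 : |2 / a j * (f (x (k + 1)) - f (x k)) * S (k + 1)| ≤ 2 / a j * ε₂ * B := by
      rw [abs_mul, abs_mul, abs_of_pos (show 0 < 2 / a j by positivity)]
      have := hmodf _ _ (hx (k + 1)) (hx k) ((hdx' k).trans (min_le_left _ _))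
      rw [Real.norm_eq_abs] at this
      have := hSB (k + 1)
      gcongr
    have b2 : |∑ p, 2 * (a p / a j) * (fderiv ℝ f (x (k + 1)) - fderiv ℝ f (x k)) (e p)
        * T p (k + 1)| ≤ n * (2 * ρ * ε₂ * B) := by
      refine (Finset.abs_sum_le_sum_abs _ _).trans ?_
      refine (Finset.sum_le_card_nsmul _ _ (2 * ρ * ε₂ * B) fun p _ => ?_).trans_eq (by
        rw [nsmul_eq_mul, Finset.card_univ])
      refine (hcoef p _ _ (hTB p (k + 1))).trans ?_
      have := hmodD _ _ (hx (k + 1)) (hx k) ((hdx' k).trans (min_le_right _ _))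
      gcongr
    -- The factor 1/a_j cancels against ‖v‖ ≤ nρa_j; this is where the bounded amplitude ratios
    -- enter.
    have b3 : |2 / a j * (f (x k + v) - f (x k) - fderiv ℝ f (x k) v) * t k j| ≤ σ / 2 := by
      rw [abs_mul, abs_mul, abs_of_pos (show 0 < 2 / a j by positivity)]
      calc 2 / a j * |f (x k + v) - f (x k) - fderiv ℝ f (x k) v| * |t k j|
          ≤ 2 / a j * (ε * (n * (ρ * a j))) * 1 := by
            have := ht k j
            have := htaylor.trans (mul_le_mul_of_nonneg_left hv1 (show 0 ≤ ε by positivity))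
            gcongr
        _ = 2 * ε * (n * ρ) := by field_simp
        _ ≤ 2 * ε * (n * ρ + 1) := by
            have : 0 ≤ ε := by positivity
            nlinarith
        _ = σ / 2 := by rw [hε]; field_simp; ring
    have b4 : 2 / a j * ε₂ * B + n * (2 * ρ * ε₂ * B) ≤ σ / 2 := by
      calc 2 / a j * ε₂ * B + n * (2 * ρ * ε₂ * B)
          ≤ ε₂ * (2 / a j * B + n * (2 * ρ * B) + 1) := by nlinarith
        _ = σ / 2 := by
          rw [hε₂]
          have : 2 / a j * B + n * (2 * ρ * B) + 1 ≠ 0 := by positivity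
          field_simp
    refine (abs_sub _ _).trans ?_
    have := abs_add_le (2 / a j * (f (x (k + 1)) - f (x k)) * S (k + 1))
      (∑ p, 2 * (a p / a j) * (fderiv ℝ f (x (k + 1)) - fderiv ℝ f (x k)) (e p) * T p (k + 1))
    linarith

end Averaging

/-! ### Existence and uniqueness for strongly monotone variational inequalities. -/

section VariationalInequality

variable {E : Type*} [NormedAddCommGroup E] [InnerProductSpace ℝ E]
  {F : E → E} {C : Set E} {π : E → E} {m L γ : ℝ}

theorem IsStrongVI.vi_unique (h : IsStrongVI F C π m L γ) {x y : E} (hx : x ∈ C) (hy : y ∈ C)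
    (hvx : ∀ z ∈ C, 0 ≤ inner ℝ (F x) (z - x)) (hvy : ∀ z ∈ C, 0 ≤ inner ℝ (F y) (z - y)) :
    x = y := by
  have h1 := hvx y hy
  have h2 := hvy x hx
  have h3 := h.mono x y
  have e : inner ℝ (x - y) (F x - F y) = -(inner ℝ (F x) (y - x) + inner ℝ (F y) (x - y)) := by
    rw [real_inner_comm]
    simp only [inner_sub_left, inner_sub_right]
    ring
  have h4 : ‖x - y‖ ^ 2 = 0 :=
    le_antisymm (by have := h.m_pos; by_contra! hc; nlinarith [mul_pos this hc]) (sq_nonneg _)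
  exact sub_eq_zero.1 (norm_eq_zero.1 (pow_eq_zero_iff two_ne_zero |>.1 h4))

/-- Banach's fixed point theorem for the projected step of length τ = m/(m² + L²) in place of γ,
which may be too long for a contraction. Using m² + L² avoids having to compare m with L or to
exclude L = 0. -/
theorem IsStrongVI.exists_vi [CompleteSpace E] (h : IsStrongVI F C π m L γ) :
    ∃ x ∈ C, ∀ z ∈ C, 0 ≤ inner ℝ (F x) (z - x) := by
  have hm := h.m_pos
  set s := m ^ 2 + L ^ 2 with hs
  have hs0 : 0 < s := by positivity
  set τ := m / s with hτ
  have hτ0 : 0 < τ := by positivity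
  set κ : NNReal := (Real.sqrt (1 - m ^ 2 / s)).toNNReal with hκ
  have hq1 : 0 ≤ 1 - m ^ 2 / s := by
    rw [sub_nonneg, div_le_one hs0]; nlinarith [sq_nonneg L]
  have hq2 : 1 - m ^ 2 / s < 1 := by
    have : 0 < m ^ 2 / s := by positivity
    linarith
  have hcontr : ContractingWith κ (fun x => π (x - τ • F x)) := by
    constructor
    · rw [hκ, ← Real.toNNReal_one, Real.toNNReal_lt_toNNReal_iff one_pos]
      exact (Real.sqrt_lt' one_pos).2 (by simpa using hq2)
    · refine LipschitzWith.of_dist_le_mul fun x y => ?_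
      rw [dist_eq_norm, dist_eq_norm, hκ, Real.coe_toNNReal _ (Real.sqrt_nonneg _)]
      refine (h.proj.norm_map_sub_le _ _).trans ?_
      refine le_of_sq_le_sq ?_ (by positivity)
      rw [mul_pow, Real.sq_sqrt hq1]
      have e : x - τ • F x - (y - τ • F y) = (x - y) - τ • (F x - F y) := by module
      rw [e, norm_sub_sq_real, inner_smul_right, norm_smul, Real.norm_of_nonneg hτ0.le, mul_pow]
      have h1 := mul_le_mul_of_nonneg_left (h.mono x y) hτ0.le
      have h2 : ‖F x - F y‖ ^ 2 ≤ L ^ 2 * ‖x - y‖ ^ 2 := by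
        rw [← mul_pow]; exact pow_le_pow_left₀ (norm_nonneg _) (h.lip x y) 2
      have h3 := mul_le_mul_of_nonneg_left h2 (sq_nonneg τ)
      have h4 : 2 * τ * m - τ ^ 2 * L ^ 2 = m ^ 2 / s + (m ^ 2 / s) ^ 2 := by
        rw [hτ]; field_simp; rw [hs]; ring
      have h5 : 0 ≤ (m ^ 2 / s) ^ 2 * ‖x - y‖ ^ 2 := by positivity
      linear_combination h3 + 2 * h1 + h5 - ‖x - y‖ ^ 2 * h4
  have : Nonempty E := ⟨0⟩
  have hfix := hcontr.fixedPoint_isFixedPt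
  set x := ContractingWith.fixedPoint _ hcontr
  have hx : π (x - τ • F x) = x := hfix
  have h1 := h.proj (x - τ • F x)
  rw [hx] at h1
  refine ⟨x, h1.1, fun z hz => ?_⟩
  have h2 := h1.2 z hz
  have e : x - τ • F x - x = -(τ • F x) := by abel
  rw [e, inner_neg_left, inner_smul_left, RCLike.conj_to_real] at h2
  exact nonneg_of_mul_nonneg_right (by linarith) hτ0

theorem IsMetricProjection.of_norm_minimizer {C : Set E} (hC : Convex ℝ C) {π : E → E}
    (hπ : ∀ y, π y ∈ C ∧ ∀ q ∈ C, ‖y - π y‖ ≤ ‖y - q‖) : IsMetricProjection C π := by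
  intro y
  obtain ⟨h1, h2⟩ := hπ y
  refine ⟨h1, (norm_eq_iInf_iff_real_inner_le_zero hC h1).1 ?_⟩
  have : Nonempty C := ⟨⟨_, h1⟩⟩
  exact le_antisymm (le_ciInf fun q => h2 q q.2)
    (ciInf_le (f := fun q : C => ‖y - q‖) ⟨0, by rintro _ ⟨q, rfl⟩; exact norm_nonneg _⟩ ⟨_, h1⟩)

theorem ConvexOn.add_fderiv_le {f : E → ℝ} (hf : ConvexOn ℝ Set.univ f) {x : E}
    {f' : E →L[ℝ] ℝ} (hf' : HasFDerivAt f f' x) (y : E) : f x + f' (y - x) ≤ f y := by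
  have h1 : ConvexOn ℝ Set.univ (fun t : ℝ => f (x + t • (y - x))) := by
    have := hf.comp_affineMap (AffineMap.lineMap x y : ℝ →ᵃ[ℝ] E)
    refine this.congr fun t _ => ?_
    simp [AffineMap.lineMap_apply, add_comm]
  have h2 : HasDerivAt (fun t : ℝ => f (x + t • (y - x))) (f' (y - x)) 0 := by
    have h3 : HasDerivAt (fun t : ℝ => x + t • (y - x)) (y - x) 0 := by
      simpa using ((hasDerivAt_id (0 : ℝ)).smul_const (y - x)).const_add x
    have h4 : HasFDerivAt f f' (x + (0 : ℝ) • (y - x)) := by simpa using hf'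
    exact h4.comp_hasDerivAt 0 h3
  have h3 := h1.le_slope_of_hasDerivAt (Set.mem_univ 0) (Set.mem_univ 1) one_pos h2
  have h4 : f' (y - x) ≤ f y - f x := by simpa [slope_def_field] using h3
  linarith

end VariationalInequality

/-! ### Coordinates of the game, Nash equilibria as variational solutions, and oscillators. -/

section GameStructure

variable {M : ℕ} {d : Fin M → ℕ}

theorem PiLp.norm_le_sum_norm {ι : Type*} [Fintype ι] {G : ι → Type*}
    [∀ i, NormedAddCommGroup (G i)] (x : PiLp 2 G) : ‖x‖ ≤ ∑ i, ‖x i‖ := by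
  rw [PiLp.norm_eq_of_L2]
  exact Real.sqrt_le_iff.2 ⟨Finset.sum_nonneg fun _ _ => norm_nonneg _,
    Finset.sum_sq_le_sq_sum_of_nonneg fun _ _ => norm_nonneg _⟩

theorem Profile.norm_le_sum_abs (y : Profile d) :
    ‖y‖ ≤ ∑ p : (i : Fin M) × Fin (d i), |y p.1 p.2| := by
  rw [Fintype.sum_sigma]
  exact (PiLp.norm_le_sum_norm y).trans (Finset.sum_le_sum fun i _ => PiLp.norm_le_sum_norm (y i))

/-- The inclusion of the decision space of agent `i` into the space of profiles. -/
noncomputable def agentEmbedding (i : Fin M) : EuclideanSpace ℝ (Fin (d i)) →L[ℝ] Profile d :=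
  (PiLp.continuousLinearEquiv 2 ℝ fun i : Fin M => EuclideanSpace ℝ (Fin (d i))).symm.toContinuousLinearMap ∘L
    ContinuousLinearMap.single ℝ (fun i : Fin M => EuclideanSpace ℝ (Fin (d i))) i

theorem agentEmbedding_apply (i : Fin M) (v : EuclideanSpace ℝ (Fin (d i))) :
    agentEmbedding i v = (WithLp.toLp 2 (Pi.single i v) : Profile d) := rfl

theorem norm_agentEmbedding (i : Fin M) (v : EuclideanSpace ℝ (Fin (d i))) :
    ‖agentEmbedding i v‖ = ‖v‖ := by
  rw [agentEmbedding_apply]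
  exact PiLp.norm_single 2 (fun i : Fin M => EuclideanSpace ℝ (Fin (d i))) i v

theorem deviate_eq (x : Profile d) (i : Fin M) (v : EuclideanSpace ℝ (Fin (d i))) :
    deviate x i v = x + agentEmbedding i (v - x i) := by
  rw [agentEmbedding_apply]
  ext k
  by_cases hk : k = i
  · subst hk; simp [deviate]
  · simp [deviate, hk]

theorem deviate_self (x : Profile d) (i : Fin M) : deviate x i (x i) = x := by
  simp [deviate_eq]

theorem hasFDerivAt_deviate {f : Profile d → ℝ} (hf : Differentiable ℝ f) (x : Profile d)
    (i : Fin M) :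
    HasFDerivAt (fun v => f (deviate x i v)) (fderiv ℝ f x ∘L agentEmbedding i) (x i) := by
  have h1 : HasFDerivAt (fun v => deviate x i v) (agentEmbedding i) (x i) := by
    have : (fun v => deviate x i v) = fun v => x + agentEmbedding i (v - x i) :=
      funext fun v => deviate_eq x i v
    rw [this]
    have h2 := ((agentEmbedding (d := d) i).hasFDerivAt.comp (x i)
      ((hasFDerivAt_id (x i)).sub_const (x i))).const_add x
    simpa using h2
  have h2 : HasFDerivAt f (fderiv ℝ f x) (deviate x i (x i)) := by
    rw [deviate_self]; exact (hf x).hasFDerivAt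
  exact h2.comp (x i) h1

theorem inner_pseudogradient {J : Fin M → Profile d → ℝ} (hJ : ∀ i, Differentiable ℝ (J i))
    (x : Profile d) (i : Fin M) (v : EuclideanSpace ℝ (Fin (d i))) :
    inner ℝ (pseudogradient J x i) v = fderiv ℝ (J i) x (agentEmbedding i v) := by
  have h1 : pseudogradient J x i = gradient (fun v => J i (deviate x i v)) (x i) := rfl
  rw [h1, gradient, (hasFDerivAt_deviate (hJ i) x i).fderiv,
    InnerProductSpace.toDual_symm_apply]
  rfl

/-- The unit vector of coordinate `j` of agent `i`. -/
noncomputable def coordVec (p : (i : Fin M) × Fin (d i)) : Profile d :=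
  agentEmbedding p.1 (EuclideanSpace.single p.2 1)

theorem norm_coordVec (p : (i : Fin M) × Fin (d i)) : ‖coordVec p‖ = 1 := by
  rw [coordVec, norm_agentEmbedding, PiLp.norm_single, norm_one]

theorem pseudogradient_apply {J : Fin M → Profile d → ℝ} (hJ : ∀ i, Differentiable ℝ (J i))
    (x : Profile d) (p : (i : Fin M) × Fin (d i)) :
    pseudogradient J x p.1 p.2 = fderiv ℝ (J p.1) x (coordVec p) := by
  rw [coordVec, ← inner_pseudogradient hJ, EuclideanSpace.inner_single_right]
  simp

theorem sum_smul_coordVec (y : Profile d) :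
    ∑ p : (i : Fin M) × Fin (d i), y p.1 p.2 • coordVec p = y := by
  rw [Fintype.sum_sigma]
  have h1 : ∀ i, ∑ j : Fin (d i), y i j • coordVec ⟨i, j⟩ = agentEmbedding i (y i) := by
    intro i
    have h2 : ∑ j : Fin (d i), y i j • EuclideanSpace.single j (1 : ℝ) = y i := by
      ext j
      simp [Finset.sum_apply, Pi.single_apply]
    conv_rhs => rw [← h2, map_sum]
    simp only [coordVec, map_smul]
  simp only [h1, agentEmbedding_apply]
  ext i : 1
  simp [Finset.sum_apply]

section Nash

variable {J : Fin M → Profile d → ℝ} {Ω : (i : Fin M) → Set (EuclideanSpace ℝ (Fin (d i)))}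

/-- First-order optimality of each agent sums to the variational inequality over the product;
conversely, unilateral deviations isolate one summand, and convexity makes the first-order condition
sufficient. -/
theorem isNash_iff_vi (hJ : ∀ i, Differentiable ℝ (J i))
    (hJc : ∀ i (x : Profile d), ConvexOn ℝ Set.univ fun v => J i (deviate x i v))
    (hΩ : ∀ i, Convex ℝ (Ω i)) (x : Profile d) :
    IsNash J Ω x ↔ x ∈ actionSet Ω ∧
      ∀ y ∈ actionSet Ω, 0 ≤ inner ℝ (pseudogradient J x) (y - x) := by
  refine and_congr_right fun hx => ⟨fun h y hy => ?_, fun h i v hv => ?_⟩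
  · rw [PiLp.inner_apply]
    refine Finset.sum_nonneg fun i _ => ?_
    rw [inner_pseudogradient hJ]
    have hmin : IsLocalMinOn (fun v => J i (deviate x i v)) (Ω i) (x i) :=
      IsMinOn.localize fun v hv => by
        simpa only [Set.mem_ofPred_eq, deviate_self] using h i v hv
    exact hmin.hasFDerivWithinAt_nonneg (hasFDerivAt_deviate (hJ i) x i).hasFDerivWithinAt
      (sub_mem_posTangentConeAt_of_segment_subset ((hΩ i).segment_subset (hx i) (hy i)))
  · have h1 := (hJc i x).add_fderiv_le (hasFDerivAt_deviate (hJ i) x i) v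
    rw [deviate_self] at h1
    have hmem : deviate x i v ∈ actionSet Ω := by
      intro k
      by_cases hk : k = i
      · subst hk; simpa [deviate] using hv
      · simpa [deviate, hk] using hx k
    have h2 := h _ hmem
    rw [PiLp.inner_apply, Finset.sum_eq_single i] at h2
    · have e : (deviate x i v - x) i = v - x i := by simp [deviate]
      rw [e, inner_pseudogradient hJ] at h2
      exact (le_add_of_nonneg_right h2).trans h1
    · intro k _ hk
      have e : (deviate x i v - x) k = 0 := by simp [deviate, hk]
      rw [e, inner_zero_right]
    · simp

theorem convex_actionSet (hΩ : ∀ i, Convex ℝ (Ω i)) : Convex ℝ (actionSet Ω) :=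
  fun _ hx _ hy _ _ ha hb hab i => hΩ i (hx i) (hy i) ha hb hab

theorem isClosed_actionSet (hΩ : ∀ i, IsClosed (Ω i)) : IsClosed (actionSet Ω) := by
  have : actionSet Ω = ⋂ i, (fun x : Profile d => x i) ⁻¹' Ω i := by
    ext x; simp [actionSet]
  rw [this]
  exact isClosed_iInter fun i => (hΩ i).preimage (by fun_prop)

theorem nonempty_actionSet (hΩ : ∀ i, (Ω i).Nonempty) : (actionSet Ω).Nonempty := by
  choose v hv using hΩ
  exact ⟨WithLp.toLp 2 v, hv⟩

theorem exists_norm_sub_le_of_mem_actionSet (hΩ : ∀ i, Bornology.IsBounded (Ω i)) :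
    ∃ B, ∀ y ∈ actionSet Ω, ∀ z ∈ actionSet Ω, ‖y - z‖ ≤ B := by
  choose b hb using fun i => (Metric.isBounded_iff.1 (hΩ i))
  refine ⟨∑ i, b i, fun y hy z hz => (PiLp.norm_le_sum_norm _).trans
    (Finset.sum_le_sum fun i _ => ?_)⟩
  have := hb i (hy i) (hz i)
  rwa [dist_eq_norm] at this

theorem isMetricProjection_euclideanProj {C : Set (Profile d)} (hne : C.Nonempty)
    (hcl : IsClosed C) (hC : Convex ℝ C) : IsMetricProjection C (euclideanProj C) := by
  refine IsMetricProjection.of_norm_minimizer hC fun y => ?_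
  refine Classical.epsilon_spec (p := fun p => p ∈ C ∧ ∀ q ∈ C, ‖y - p‖ ≤ ‖y - q‖) ?_
  obtain ⟨p, hp, h⟩ := exists_norm_eq_iInf_of_complete_convex hne hcl.isComplete hC y
  refine ⟨p, hp, fun q hq => ?_⟩
  rw [h]
  exact ciInf_le (f := fun q : C => ‖y - q‖) ⟨0, by rintro _ ⟨q, rfl⟩; exact norm_nonneg _⟩ ⟨q, hq⟩

end Nash

section Oscillators

theorem exists_angle {a b : ℝ} (h : a ^ 2 + b ^ 2 = 1) : ∃ θ, a = Real.cos θ ∧ b = Real.sin θ := by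
  have hn : ‖(⟨a, b⟩ : ℂ)‖ = 1 := by
    rw [Complex.norm_eq_sqrt_sq_add_sq, h, Real.sqrt_one]
  have h0 : (⟨a, b⟩ : ℂ) ≠ 0 := by
    intro h0; rw [h0, norm_zero] at hn; exact zero_ne_one hn
  refine ⟨Complex.arg ⟨a, b⟩, ?_, ?_⟩
  · rw [Complex.cos_arg h0, hn, div_one]
  · rw [Complex.sin_arg, hn, div_one]

theorem oscillator_eq {ω : (i : Fin M) → Fin (d i) → ℝ} {μ : ℕ → Oscillators d}
    (h0 : μ 0 ∈ torus d) (hμ : ∀ k, μ (k + 1) = rotate ω (μ k)) (p : (i : Fin M) × Fin (d i)) :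
    ∃ θ, ∀ k : ℕ, μ k p.1 p.2 0 = Real.cos (θ + k * ω p.1 p.2) ∧
      μ k p.1 p.2 1 = Real.sin (θ + k * ω p.1 p.2) := by
  obtain ⟨θ, h1, h2⟩ := exists_angle (h0 p.1 p.2)
  refine ⟨θ, fun k => ?_⟩
  induction k with
  | zero => simpa using ⟨h1, h2⟩
  | succ k ih =>
    have e : θ + ((k + 1 : ℕ) : ℝ) * ω p.1 p.2 = (θ + k * ω p.1 p.2) + ω p.1 p.2 := by
      push_cast; ring
    rw [hμ, e, Real.cos_add (θ + _), Real.sin_add (θ + _), ← ih.1, ← ih.2]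
    constructor <;> simp [rotate] <;> ring

theorem mem_torus_of_rotate {ω : (i : Fin M) → Fin (d i) → ℝ} {μ : ℕ → Oscillators d}
    (h0 : μ 0 ∈ torus d) (hμ : ∀ k, μ (k + 1) = rotate ω (μ k)) (k : ℕ) : μ k ∈ torus d := by
  intro i j
  obtain ⟨θ, h⟩ := oscillator_eq h0 hμ ⟨i, j⟩
  have := h k
  dsimp only at this
  rw [this.1, this.2, Real.cos_sq_add_sin_sq]

/-- Non-resonant oscillators and their products average out, uniformly in the initial phases. -/
theorem exists_oscillator_primitives (ω : (i : Fin M) → Fin (d i) → ℝ)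
    (hω_add : ∀ i j u v, ∀ n : ℤ, ω i j + ω u v ≠ 2 * Real.pi * n)
    (hω_sub : ∀ i j u v, (⟨i, j⟩ : (i : Fin M) × Fin (d i)) ≠ ⟨u, v⟩ →
      ∀ n : ℤ, ω i j - ω u v ≠ 2 * Real.pi * n) :
    ∃ B, 0 ≤ B ∧ ∀ μ : ℕ → Oscillators d, μ 0 ∈ torus d → (∀ k, μ (k + 1) = rotate ω (μ k)) →
      ∀ p : (i : Fin M) × Fin (d i), (∀ k, |μ k p.1 p.2 0| ≤ 1) ∧
        HasBoundedPrimitive B (fun k => μ k p.1 p.2 0) ∧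
        ∀ q : (i : Fin M) × Fin (d i), HasBoundedPrimitive B
          (fun k => μ k p.1 p.2 0 * μ k q.1 q.2 0 - if p = q then 1 / 2 else 0) := by
  set I := (i : Fin M) × Fin (d i)
  -- A single resonant frequency would make the sum of that frequency with itself resonant.
  have hω1 : ∀ p : I, ∀ n : ℤ, ω p.1 p.2 ≠ 2 * Real.pi * n := fun p n hn =>
    hω_add p.1 p.2 p.1 p.2 (2 * n) (by push_cast; linarith)
  choose B₁ hB₁0 hB₁ using fun p : I => exists_hasBoundedPrimitive_cos (hω1 p)
  choose B₂ hB₂0 hB₂ using fun r : I × I =>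
    exists_hasBoundedPrimitive_cos (hω_add r.1.1 r.1.2 r.2.1 r.2.2)
  have hdiff : ∀ r : I × I, ∃ B, 0 ≤ B ∧ ∀ φ, r.1 ≠ r.2 → HasBoundedPrimitive B
      (fun k : ℕ => Real.cos (φ + k * (ω r.1.1 r.1.2 - ω r.2.1 r.2.2))) := by
    intro r
    by_cases hr : r.1 = r.2
    · exact ⟨0, le_rfl, fun φ h => absurd hr h⟩
    · obtain ⟨B, h0, h⟩ := exists_hasBoundedPrimitive_cos (hω_sub r.1.1 r.1.2 r.2.1 r.2.2 hr)
      exact ⟨B, h0, fun φ _ => h φ⟩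
  choose B₃ hB₃0 hB₃ using hdiff
  have hs1 : ∀ p, B₁ p ≤ ∑ p, B₁ p := fun p =>
    Finset.single_le_sum (fun q _ => hB₁0 q) (Finset.mem_univ p)
  have hs2 : ∀ p, B₂ p ≤ ∑ p, B₂ p := fun p =>
    Finset.single_le_sum (fun q _ => hB₂0 q) (Finset.mem_univ p)
  have hs3 : ∀ p, B₃ p ≤ ∑ p, B₃ p := fun p =>
    Finset.single_le_sum (fun q _ => hB₃0 q) (Finset.mem_univ p)
  have hn1 : 0 ≤ ∑ p, B₁ p := Finset.sum_nonneg fun p _ => hB₁0 p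
  have hn2 : 0 ≤ ∑ p, B₂ p := Finset.sum_nonneg fun p _ => hB₂0 p
  have hn3 : 0 ≤ ∑ p, B₃ p := Finset.sum_nonneg fun p _ => hB₃0 p
  refine ⟨∑ p, B₁ p + ∑ p, B₂ p + ∑ p, B₃ p, by positivity, fun μ h0 hμ p => ?_⟩
  obtain ⟨θ, hθ⟩ := oscillator_eq h0 hμ p
  refine ⟨fun k => ?_, ?_, fun q => ?_⟩
  · rw [(hθ k).1]; exact Real.abs_cos_le_one _
  · simp only [fun k => (hθ k).1]
    exact (hB₁ p θ).mono (by linarith [hs1 p])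
  · obtain ⟨φ, hφ⟩ := oscillator_eq h0 hμ q
    by_cases hpq : p = q
    · subst hpq
      have h1 : (fun k => μ k p.1 p.2 0 * μ k p.1 p.2 0 - if p = p then 1 / 2 else 0)
          = fun k : ℕ => (Real.cos ((θ + θ) + k * (ω p.1 p.2 + ω p.1 p.2)) + 0) / 2 := by
        funext k
        have e : (θ + θ) + k * (ω p.1 p.2 + ω p.1 p.2) = 2 * (θ + k * ω p.1 p.2) := by ring
        rw [e, Real.cos_two_mul, if_pos rfl, (hθ k).1]; ring
      rw [h1]
      -- On the diagonal the difference-frequency cosine is the constant 1, removed by subtracting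
      -- 1/2.
      have h2 : HasBoundedPrimitive 0 (fun _ => 0) := ⟨fun _ => 0, by simp, by simp⟩
      exact ((hB₂ (p, p) (θ + θ)).half_add h2).mono (by linarith [hs2 (p, p)])
    · have h1 : (fun k => μ k p.1 p.2 0 * μ k q.1 q.2 0 - if p = q then 1 / 2 else 0)
          = fun k : ℕ => (Real.cos ((θ + φ) + k * (ω p.1 p.2 + ω q.1 q.2))
            + Real.cos ((θ - φ) + k * (ω p.1 p.2 - ω q.1 q.2))) / 2 := by
        funext k
        have e1 : (θ + φ) + k * (ω p.1 p.2 + ω q.1 q.2)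
            = (θ + k * ω p.1 p.2) + (φ + k * ω q.1 q.2) := by ring
        have e2 : (θ - φ) + k * (ω p.1 p.2 - ω q.1 q.2)
            = (θ + k * ω p.1 p.2) - (φ + k * ω q.1 q.2) := by ring
        rw [e1, e2, Real.cos_add, Real.cos_sub, if_neg hpq, (hθ k).1, (hφ k).1]; ring
      rw [h1]
      exact ((hB₂ (p, q) (θ + φ)).half_add (hB₃ (p, q) (θ - φ) hpq)).mono
        (by linarith [hs2 (p, q), hs3 (p, q)])

end Oscillators

end GameStructure

/-! ### Choice of the parameters and proof of practical stability. -/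

section Assembly

variable {M : ℕ} {d : Fin M → ℕ}

theorem exists_pos_forall_le {ι : Type*} [Finite ι] {f : ι → ℝ} (hf : ∀ p, 0 < f p) :
    ∃ δ > 0, ∀ p, δ ≤ f p := by
  have h : ∀ᶠ δ : ℝ in 𝓝[>] 0, ∀ p, δ ≤ f p :=
    eventually_all.2 fun p => ((eventually_le_nhds (hf p)).filter_mono nhdsWithin_le_nhds)
  obtain ⟨δ, h1, h2⟩ := (h.and self_mem_nhdsWithin).exists
  exact ⟨δ, h2, h1⟩

theorem le_maxAmplitude (a : (i : Fin M) → Fin (d i) → ℝ) (p : (i : Fin M) × Fin (d i)) :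
    a p.1 p.2 ≤ maxAmplitude a :=
  le_ciSup (f := fun p : (i : Fin M) × Fin (d i) => a p.1 p.2) (Set.finite_range _).bddAbove p

theorem scale_dither (a : (i : Fin M) → Fin (d i) → ℝ) (μ : Oscillators d) :
    scale a (dither μ) = ∑ p : (i : Fin M) × Fin (d i), (a p.1 p.2 * μ p.1 p.2 0) • coordVec p :=
  (sum_smul_coordVec (scale a (dither μ))).symm

/-- Along slow trajectories the zeroth-order estimate equals the pseudogradient up to a small error
and a coboundary. -/
theorem exists_profile_corrector {J : Fin M → Profile d → ℝ} (hJ : ∀ i, ContDiff ℝ 1 (J i))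
    {ω : (i : Fin M) → Fin (d i) → ℝ}
    (hω_add : ∀ i j u v, ∀ n : ℤ, ω i j + ω u v ≠ 2 * Real.pi * n)
    (hω_sub : ∀ i j u v, (⟨i, j⟩ : (i : Fin M) × Fin (d i)) ≠ ⟨u, v⟩ →
      ∀ n : ℤ, ω i j - ω u v ≠ 2 * Real.pi * n)
    {ρ : ℝ} (hρ : 0 ≤ ρ) (R R₁ : ℝ) {σ : ℝ} (hσ : 0 < σ) :
    ∃ amax > 0, ∀ a ∈ amplitudes d ρ, maxAmplitude a < amax →
      ∃ αmax > 0, ∀ α, 0 < α → α < αmax → ∀ (x : ℕ → Profile d) (μ : ℕ → Oscillators d),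
        (∀ k, ‖x k‖ ≤ R) → (∀ k, ‖x (k + 1) - x k‖ ≤ α * R₁) → μ 0 ∈ torus d →
        (∀ k, μ (k + 1) = rotate ω (μ k)) →
        ∃ P : ℕ → Profile d, (∀ k, ‖α • P k‖ ≤ σ) ∧
          ∀ k, ‖P (k + 1) - P k
            - (gradientEstimate J a (x k) (μ k) - pseudogradient J (x k))‖ ≤ σ := by
  obtain ⟨B, hB, hosc⟩ := exists_oscillator_primitives ω hω_add hω_sub
  set I := (i : Fin M) × Fin (d i)
  set n : ℝ := (Fintype.card I : ℝ) with hn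
  have hn0 : 0 ≤ n := Nat.cast_nonneg _
  have hσn : 0 < σ / (n + 1) := by positivity
  have hsum : ∀ y : Profile d, (∀ p : I, |y p.1 p.2| ≤ σ / (n + 1)) → ‖y‖ ≤ σ := by
    intro y hy
    refine (Profile.norm_le_sum_abs y).trans
      ((Finset.sum_le_card_nsmul _ _ _ fun p _ => hy p).trans ?_)
    rw [nsmul_eq_mul, Finset.card_univ, ← hn, mul_div_assoc', div_le_iff₀ (by positivity)]
    nlinarith
  choose amax hamax hcorr using fun p : I =>
    exists_corrector (hJ p.1) (e := coordVec) (fun q => (norm_coordVec q).le) p hρ hB R R₁ hσn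
  obtain ⟨a₀, ha₀, ha₀le⟩ := exists_pos_forall_le hamax
  refine ⟨a₀, ha₀, fun a ha hasmall => ?_⟩
  choose αmax hαmax hcorr using fun p : I => hcorr p (fun q => a q.1 q.2) (fun q => ha.1 q.1 q.2)
    (fun q r => ha.2 q.1 q.2 r.1 r.2)
    (fun q => (le_maxAmplitude a q).trans_lt (hasmall.trans_le (ha₀le p)))
  obtain ⟨α₀, hα₀, hα₀le⟩ := exists_pos_forall_le hαmax
  refine ⟨α₀, hα₀, fun α hα hαlt x μ hx hdx h0 hμ => ?_⟩
  choose P hP1 hP2 using fun p : I => hcorr p α hα (hαlt.trans_le (hα₀le p)) x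
    (fun k q => μ k q.1 q.2 0) hx hdx (fun k q => (hosc μ h0 hμ q).1 k) (hosc μ h0 hμ p).2.1
    (hosc μ h0 hμ p).2.2
  refine ⟨fun k => WithLp.toLp 2 fun i => WithLp.toLp 2 fun j => P ⟨i, j⟩ k,
    fun k => hsum _ fun p => hP1 p k, fun k => hsum _ fun p => ?_⟩
  have h1 := hP2 p k
  rw [← scale_dither, ← pseudogradient_apply fun i => (hJ i).differentiable one_ne_zero] at h1
  exact h1

theorem State.norm_sub_sq (z w : State d) :
    ‖z - w‖ ^ 2 = ‖z.x - w.x‖ ^ 2 + (‖z.ξ - w.ξ‖ ^ 2 + ‖z.μ - w.μ‖ ^ 2) := by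
  rw [WithLp.prod_norm_sq_eq_of_L2, WithLp.prod_norm_sq_eq_of_L2 (z - w).snd]
  rfl

theorem isClosed_torus : IsClosed (torus d) := by
  have : torus d = ⋂ i, ⋂ j, {μ : Oscillators d | μ i j 0 ^ 2 + μ i j 1 ^ 2 = 1} := by
    ext μ; simp [torus]
  rw [this]
  exact isClosed_iInter fun i => isClosed_iInter fun j =>
    isClosed_eq (by fun_prop) continuous_const

theorem nonempty_torus : (torus d).Nonempty :=
  ⟨WithLp.toLp 2 fun _ => WithLp.toLp 2 fun _ => !₂[1, 0], fun i j => by simp⟩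

variable {J : Fin M → Profile d → ℝ} {Ω : (i : Fin M) → Set (EuclideanSpace ℝ (Fin (d i)))}

theorem isClosed_targetSet (xs : Profile d) : IsClosed (targetSet J Ω xs) := by
  have hx : Continuous (State.x : State d → Profile d) := by
    unfold State.x; fun_prop
  have hξ : Continuous (State.ξ : State d → Profile d) := by
    unfold State.ξ; fun_prop
  have hμ : Continuous (State.μ : State d → Oscillators d) := by
    unfold State.μ; fun_prop
  exact (isClosed_eq hx continuous_const).inter
    ((isClosed_closure.preimage hξ).inter (isClosed_torus.preimage hμ))

/-- The distance to the closed target set is attained, and each component is bounded by the product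
norm. -/
theorem exists_near_of_infDist (hne : (gradientHull J Ω).Nonempty) (xs : Profile d)
    (z : State d) :
    ‖z.x - xs‖ ≤ Metric.infDist z (targetSet J Ω xs) ∧
      ∃ c ∈ gradientHull J Ω, ‖z.ξ - c‖ ≤ Metric.infDist z (targetSet J Ω xs) := by
  obtain ⟨c₀, hc₀⟩ := hne
  obtain ⟨μ₀, hμ₀⟩ := nonempty_torus (d := d)
  have : ProperSpace (State d) := FiniteDimensional.proper ℝ (State d)
  obtain ⟨w, ⟨hw1, hw2, -⟩, hw⟩ := (isClosed_targetSet (J := J) (Ω := Ω) xs).exists_infDist_eq_dist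
    ⟨State.mk xs c₀ μ₀, rfl, hc₀, hμ₀⟩ z
  have h := State.norm_sub_sq z w
  rw [hw, dist_eq_norm]
  refine ⟨?_, w.ξ, hw2, ?_⟩
  · rw [← hw1]
    exact le_of_sq_le_sq (by rw [h]; nlinarith [sq_nonneg ‖z.ξ - w.ξ‖, sq_nonneg ‖z.μ - w.μ‖])
      (norm_nonneg _)
  · exact le_of_sq_le_sq (by rw [h]; nlinarith [sq_nonneg ‖z.x - w.x‖, sq_nonneg ‖z.μ - w.μ‖])
      (norm_nonneg _)

theorem infDist_targetSet_le (xs : Profile d) (z : State d) (hz : z.μ ∈ torus d) {c : Profile d}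
    (hc : c ∈ gradientHull J Ω) :
    Metric.infDist z (targetSet J Ω xs) ≤ ‖z.x - xs‖ + ‖z.ξ - c‖ := by
  have hmem : State.mk xs c z.μ ∈ targetSet J Ω xs := ⟨rfl, hc, hz⟩
  refine (Metric.infDist_le_dist_of_mem hmem).trans ?_
  have h := State.norm_sub_sq z (State.mk xs c z.μ)
  have e1 : (State.mk xs c z.μ).x = xs := rfl
  have e2 : (State.mk xs c z.μ).ξ = c := rfl
  have e3 : (State.mk xs c z.μ).μ = z.μ := rfl
  rw [e1, e2, e3, sub_self, norm_zero] at h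
  rw [dist_eq_norm]
  refine le_of_sq_le_sq ?_ (by positivity)
  rw [h]
  nlinarith [mul_nonneg (norm_nonneg (z.x - xs)) (norm_nonneg (z.ξ - c))]

/-- The square root comes from the bound r + r² on the squared distance of the decisions; the
summand r serves the filter. -/
theorem isClassKL_exp {A c : ℝ} (hA : 0 < A) (hc : 0 < c) :
    IsClassKL fun r s => A * (r + Real.sqrt (r + r ^ 2)) * Real.exp (-(c * s)) where
  continuousOn := Continuous.continuousOn (by unfold Function.uncurry; fun_prop)
  nonneg r s hr hs := by positivity
  zero s hs := by simp
  strictMonoOn s hs r hr r' hr' h := by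
    have hr : 0 ≤ r := hr
    have h1 : Real.sqrt (r + r ^ 2) ≤ Real.sqrt (r' + r' ^ 2) := by gcongr
    have h2 : r + Real.sqrt (r + r ^ 2) < r' + Real.sqrt (r' + r' ^ 2) := by linarith
    exact mul_lt_mul_of_pos_right (mul_lt_mul_of_pos_left h2 hA) (Real.exp_pos _)
  antitoneOn r hr s hs s' hs' h := by
    have hr : 0 ≤ r := hr
    dsimp only
    gcongr
  tendsto r hr := by
    have h1 : Tendsto (fun s : ℝ => Real.exp (-(c * s))) atTop (𝓝 0) :=
      Real.tendsto_exp_neg_atTop_nhds_zero.comp (tendsto_id.const_mul_atTop hc)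
    simpa using h1.const_mul (A * (r + Real.sqrt (r + r ^ 2)))

/-- Semi-global practical stability of the algorithm around a solution of the variational
inequality. -/
theorem isSGPAS_trajectories {ω : (i : Fin M) → Fin (d i) → ℝ} {m L γ ρ : ℝ} (hρ : 0 ≤ ρ)
    (hJ : ∀ i, ContDiff ℝ 1 (J i))
    (h : IsStrongVI (pseudogradient J) (actionSet Ω) (euclideanProj (actionSet Ω)) m L γ)
    (hC : Convex ℝ (actionSet Ω)) {G B : ℝ} (hG : ∀ y ∈ actionSet Ω, ‖pseudogradient J y‖ ≤ G)
    (hB : ∀ y ∈ actionSet Ω, ∀ z ∈ actionSet Ω, ‖y - z‖ ≤ B)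
    (hω_add : ∀ i j u v, ∀ n : ℤ, ω i j + ω u v ≠ 2 * Real.pi * n)
    (hω_sub : ∀ i j u v, (⟨i, j⟩ : (i : Fin M) × Fin (d i)) ≠ ⟨u, v⟩ →
      ∀ n : ℤ, ω i j - ω u v ≠ 2 * Real.pi * n)
    {xs : Profile d} (hxs : xs ∈ actionSet Ω)
    (hvi : ∀ y ∈ actionSet Ω, 0 ≤ inner ℝ (pseudogradient J xs) (y - xs)) :
    IsSGPAS (trajectories J Ω ω γ) (amplitudes d ρ) maxAmplitude (targetSet J Ω xs) := by
  have hL := h.L_nonneg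
  obtain ⟨c, hc0, hc1, K₀, hK₀, hbound⟩ := h.exists_norm_sub_sq_bound hC hG hB hxs hvi
  refine ⟨_, isClassKL_exp (A := Real.sqrt K₀ + (2 * L + 1)) (c := c / 2) (by positivity)
    (by positivity), fun Δ ν hν _ => ?_⟩
  set R := max Δ B with hR
  obtain ⟨K, hK, hbound⟩ := hbound R (le_max_right _ _)
  have hB0 : 0 ≤ B := (norm_nonneg _).trans (hB xs hxs xs hxs)
  have hR0 : 0 ≤ R := hB0.trans (le_max_right _ _)
  -- The tolerance is split in halves: √(Kβ) ≤ ν/2 for the decisions and 2β ≤ ν/2 for the filter,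
  -- one β each from the corrector and from `exists_hull_near`.
  refine ⟨min (1 / 2) (min (ν / 4) (ν ^ 2 / (4 * (K + 1)))), by positivity, fun β hβ0 hβ => ?_⟩
  have hβ1 : β ≤ 1 / 2 := (hβ.trans_le (min_le_left _ _)).le
  have hβ2 : β ≤ ν / 4 := (hβ.trans_le ((min_le_right _ _).trans (min_le_left _ _))).le
  have hβ3 : β ≤ ν ^ 2 / (4 * (K + 1)) :=
    (hβ.trans_le ((min_le_right _ _).trans (min_le_right _ _))).le
  have hKβ : Real.sqrt (K * β) ≤ ν / 2 := by
    rw [Real.sqrt_le_left (by positivity)]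
    rw [le_div_iff₀ (by positivity)] at hβ3
    linarith
  -- Accuracy β/2, because the perturbation of χ has two parts, the residual of the averaging
  -- identity and the forgetting term αP.
  obtain ⟨amax, hamax, hcorr⟩ := exists_profile_corrector hJ hω_add hω_sub hρ (‖xs‖ + R) (B + R)
    (half_pos hβ0)
  refine ⟨amax, hamax, fun a ha hasmall => ?_⟩
  obtain ⟨αmax, hαmax, hcorr⟩ := hcorr a ha hasmall
  refine ⟨min αmax 1, by positivity, fun α hα0 hα z hz hz0 k => ?_⟩
  have hα1 : α ≤ 1 := (hα.trans_le (min_le_right _ _)).le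
  obtain ⟨hμ0, hstep⟩ := hz
  set r := Metric.infDist (z 0) (targetSet J Ω xs) with hr
  have hr0 : 0 ≤ r := Metric.infDist_nonneg
  have hrR : r ≤ R := hz0.trans (le_max_left _ _)
  have hx : ∀ k, (z (k + 1)).x = (1 - α * β) • (z k).x
      + (α * β) • euclideanProj (actionSet Ω) ((z k).x - γ • (z k).ξ) := fun k => by
    rw [hstep]; rfl
  have hξ : ∀ k, (z (k + 1)).ξ = (1 - α) • (z k).ξ
      + α • gradientEstimate J a (z k).x (z k).μ := fun k => by
    rw [hstep]; rfl
  have hμ : ∀ k, (z (k + 1)).μ = rotate ω (z k).μ := fun k => by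
    rw [hstep]; rfl
  have hαβ0 : 0 < α * β := by positivity
  have hαβα : α * β ≤ α := mul_le_of_le_one_right hα0.le (by linarith)
  have hne : (gradientHull J Ω).Nonempty :=
    ⟨_, subset_closure (subset_convexHull ℝ _ ⟨xs, hxs, rfl⟩)⟩
  obtain ⟨hx0, c₀, hc₀, hξ0⟩ := exists_near_of_infDist (J := J) (Ω := Ω) hne xs (z 0)
  have hball : ∀ k, ‖(z k).x - xs‖ ≤ R :=
    IsStrongVI.norm_iterate_sub_le (fun y hy => hB y hy xs hxs) hαβ0.le (hαβα.trans hα1)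
      (fun k => (h.proj _).1) hx (hx0.trans hrR) (le_max_right _ _)
  obtain ⟨P, hP1, hP2⟩ := hcorr α hα0 (hα.trans_le (min_le_left _ _)) (fun k => (z k).x)
    (fun k => (z k).μ) (fun k => by
      have e : (z k).x = xs + ((z k).x - xs) := by abel
      rw [e]
      exact (norm_add_le _ _).trans (add_le_add_right (hball k) _))
    (fun k => by
      have e : (z (k + 1)).x - (z k).x = (α * β) •
          ((euclideanProj (actionSet Ω) ((z k).x - γ • (z k).ξ) - xs) - ((z k).x - xs)) := by
        rw [hx]; module
      rw [e, norm_smul, Real.norm_of_nonneg hαβ0.le]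
      refine mul_le_mul hαβα ((norm_sub_le _ _).trans
        (add_le_add (hB _ (h.proj _).1 _ hxs) (hball k))) (norm_nonneg _) hα0.le)
    hμ0 hμ
  have hξχ : ∀ k, ‖(z k).ξ - ((z k).ξ - α • P k)‖ ≤ β := fun k => by
    rw [sub_sub_cancel]; exact (hP1 k).trans (by linarith)
  have hχ : ∀ k, ‖((z (k + 1)).ξ - α • P (k + 1))
      - ((1 - α) • ((z k).ξ - α • P k) + α • pseudogradient J (z k).x)‖ ≤ α * β := fun k => by
    have e : ((z (k + 1)).ξ - α • P (k + 1))
        - ((1 - α) • ((z k).ξ - α • P k) + α • pseudogradient J (z k).x)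
        = -(α • ((P (k + 1) - P k
            - (gradientEstimate J a (z k).x (z k).μ - pseudogradient J (z k).x)) + α • P k)) := by
      rw [hξ]; module
    rw [e, norm_neg, norm_smul, Real.norm_of_nonneg hα0.le]
    refine mul_le_mul_of_nonneg_left ((norm_add_le _ _).trans ?_) hα0.le
    linarith [hP1 k, hP2 k]
  have hχ0 : ‖((z 0).ξ - α • P 0) - c₀‖ ≤ r + β := by
    rw [sub_right_comm]
    exact (norm_sub_le _ _).trans (by linarith [hP1 0])
  have hxk := hbound β hβ0 hβ1 α hα0 hα1 r (fun k => (z k).x) (fun k => (z k).ξ)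
    (fun k => (z k).ξ - α • P k) c₀ hrR hx hξχ hχ hx0 hc₀ hχ0 k
  obtain ⟨ck, hck, hξk⟩ := h.exists_hull_near hC hxs hα0 hα1 hβ0 hβ1
    (x := fun k => (z k).x) (χ := fun k => (z k).ξ - α • P k) (fun k => (h.proj _).1) hx hχ
    hx0 hc₀ hχ0 k
  refine (infDist_targetSet_le xs (z k)
    (mem_torus_of_rotate (μ := fun k => (z k).μ) hμ0 hμ k) hck).trans ?_
  set s := α * β * (k : ℝ) with hs
  have hs0 : 0 ≤ s := by positivity
  have b1 : ‖(z k).x - xs‖ ≤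
      Real.sqrt K₀ * Real.sqrt (r + r ^ 2) * Real.exp (-(c / 2 * s)) + ν / 2 := by
    have h1 : ‖(z k).x - xs‖ ≤ Real.sqrt (K₀ * (r + r ^ 2) * Real.exp (-(c * s)) + K * β) :=
      Real.le_sqrt_of_sq_le hxk
    have h2 : Real.sqrt (K₀ * (r + r ^ 2) * Real.exp (-(c * s)))
        = Real.sqrt K₀ * Real.sqrt (r + r ^ 2) * Real.exp (-(c / 2 * s)) := by
      have e : Real.exp (-(c * s)) = Real.exp (-(c / 2 * s)) ^ 2 := by
        rw [← Real.exp_nat_mul]; congr 1; push_cast; ring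
      rw [e, Real.sqrt_mul (by positivity), Real.sqrt_mul hK₀, Real.sqrt_sq (Real.exp_pos _).le]
    have h3 : Real.sqrt (K₀ * (r + r ^ 2) * Real.exp (-(c * s)) + K * β)
        ≤ Real.sqrt (K₀ * (r + r ^ 2) * Real.exp (-(c * s))) + Real.sqrt (K * β) := by
      refine Real.sqrt_le_iff.2 ⟨by positivity, ?_⟩
      rw [add_sq, Real.sq_sqrt (by positivity), Real.sq_sqrt (by positivity)]
      have : 0 ≤ 2 * Real.sqrt (K₀ * (r + r ^ 2) * Real.exp (-(c * s))) * Real.sqrt (K * β) := by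
        positivity
      linarith
    linarith
  have b2 : ‖(z k).ξ - ck‖ ≤ (2 * L + 1) * r * Real.exp (-(c / 2 * s)) + ν / 2 := by
    have h1 : (z k).ξ - ck = ((z k).ξ - ((z k).ξ - α • P k)) + ((z k).ξ - α • P k - ck) := by abel
    -- The infeasibility rate 1 is at least c/2, so both components share one exponential.
    have h2 : (1 - α * β) ^ k ≤ Real.exp (-(c / 2 * s)) := by
      refine (one_sub_pow_le_exp (hαβα.trans hα1) k).trans (Real.exp_le_exp.2 ?_)
      nlinarith
    have h3 : (2 * L + 1) * r * (1 - α * β) ^ k ≤ (2 * L + 1) * r * Real.exp (-(c / 2 * s)) := by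
      gcongr
    rw [h1]
    exact (norm_add_le _ _).trans (by linarith [hξχ k])
  have hE := Real.exp_pos (-(c / 2 * s))
  have b3 : 0 ≤ Real.sqrt K₀ * r * Real.exp (-(c / 2 * s)) := by positivity
  have b4 : 0 ≤ (2 * L + 1) * Real.sqrt (r + r ^ 2) * Real.exp (-(c / 2 * s)) := by positivity
  linarith

end Assembly

theorem theorem2 {M : ℕ} (d : Fin M → ℕ)
    (J : Fin M → Profile d → ℝ)
    (Ω : (i : Fin M) → Set (EuclideanSpace ℝ (Fin (d i))))
    (ω : (i : Fin M) → Fin (d i) → ℝ)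
    (γ μf L ρ : ℝ)
    (hγ : 0 < γ) (hμf : 0 < μf) (hρ : 1 ≤ ρ)
    (hJ : ∀ i, ContDiff ℝ 1 (J i))
    (hJ_convex : ∀ i (x : Profile d), StrictConvexOn ℝ Set.univ fun v => J i (deviate x i v))
    (hF_mono : ∀ x y : Profile d,
      μf * ‖x - y‖ ^ 2 ≤ inner ℝ (x - y) (pseudogradient J x - pseudogradient J y))
    (hF_lip : ∀ x y : Profile d, ‖pseudogradient J x - pseudogradient J y‖ ≤ L * ‖x - y‖)
    (hΩ_nonempty : ∀ i, (Ω i).Nonempty)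
    (hΩ_convex : ∀ i, Convex ℝ (Ω i))
    (hΩ_closed : ∀ i, IsClosed (Ω i))
    (hΩ_bounded : ∀ i, Bornology.IsBounded (Ω i))
    (hω_pos : ∀ i j, 0 < ω i j)
    (hω_add : ∀ i j u v, ∀ n : ℤ, ω i j + ω u v ≠ 2 * Real.pi * n)
    (hω_sub : ∀ i j u v, (⟨i, j⟩ : (i : Fin M) × Fin (d i)) ≠ ⟨u, v⟩ →
      ∀ n : ℤ, ω i j - ω u v ≠ 2 * Real.pi * n) :
    (∃! x, IsNash J Ω x) ∧
    ∀ xs, IsNash J Ω xs →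
      IsSGPAS (trajectories J Ω ω γ) (amplitudes d ρ) maxAmplitude (targetSet J Ω xs) := by
  have hC := convex_actionSet hΩ_convex
  -- L carries no sign assumption (it may be negative when the profile space is trivial), hence the
  -- maximum with 0.
  have h : IsStrongVI (pseudogradient J) (actionSet Ω) (euclideanProj (actionSet Ω)) μf
      (max L 0) γ :=
    { m_pos := hμf
      L_nonneg := le_max_right _ _
      γ_pos := hγ
      mono := hF_mono
      lip := fun x y => (hF_lip x y).trans
        (mul_le_mul_of_nonneg_right (le_max_left _ _) (norm_nonneg _))
      proj := isMetricProjection_euclideanProj (nonempty_actionSet hΩ_nonempty)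
        (isClosed_actionSet hΩ_closed) hC }
  have hnash := isNash_iff_vi (Ω := Ω) (fun i => (hJ i).differentiable one_ne_zero)
    (fun i x => (hJ_convex i x).convexOn) hΩ_convex
  constructor
  · obtain ⟨x, hx, hvx⟩ := h.exists_vi
    refine ⟨x, (hnash x).2 ⟨hx, hvx⟩, fun y hy => ?_⟩
    obtain ⟨hy, hvy⟩ := (hnash y).1 hy
    exact h.vi_unique hy hx hvy hvx
  · intro xs hxs
    obtain ⟨hxs, hvi⟩ := (hnash xs).1 hxs
    obtain ⟨B, hB⟩ := exists_norm_sub_le_of_mem_actionSet hΩ_bounded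
    have hG : ∀ y ∈ actionSet Ω, ‖pseudogradient J y‖ ≤ ‖pseudogradient J xs‖ + max L 0 * B := by
      intro y hy
      have e : pseudogradient J y
          = pseudogradient J xs + (pseudogradient J y - pseudogradient J xs) := by abel
      rw [e]
      exact (norm_add_le _ _).trans (add_le_add_right ((h.lip _ _).trans
        (mul_le_mul_of_nonneg_left (hB y hy xs hxs) h.L_nonneg)) _)
    exact isSGPAS_trajectories (zero_le_one.trans hρ) hJ h hC hG hB hω_add hω_sub hxs hvi
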